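/- Let $n\ge 2$ and let $[n]=\{1,\dots,n\}=\mathrm D_c\sqcup \mathrm U_c$ be the partition induced by a Coxeter element $c$ of $\Sigma_n$, that is, an arbitrary partition with $1,n\in \mathrm D_c$ (so $\mathrm U_c$ is any subset of $\{2,\dots,n-1\}$). *The associahedron.* Put $\overline{\mathrm D}_c=\mathrm D_c\cup\{0,n+1\}$. Label the vertices of a convex $(n+2)$-gon $Q$ by $0,1,\dots,n+1$ so that, going counter-clockwise around the boundary, one meets first the elements of $\overline{\mathrm D}_c$ in increasing order and then the elements of $\mathrm U_c$ in decreasing order. For a proper diagonal $\delta=\{a,b\}$, $a<b$ (a segment joining two distinct non-adjacent vertices), let $R_\delta\subseteq[n]$ be the set of labels strictly to the right of $\delta$ oriented from $a$ to $b$, where $0$ (respectively $n+1$) is replaced by the smaller (respectively larger) label of those end-points of $\delta$ that lie in $\mathrm U_c$, if there are any. With the standard right-hand sides, the associahedron is $$\mathrm{As}^c_{n-1}=\Bigl\{x\in\mathbb R^n : \sum_{i=1}^n x_i=\tfrac{n(n+1)}2,\ \ \sum_{i\in R_\delta}x_i\ge \tfrac{|R_\delta|(|R_\delta|+1)}2\text{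 for every proper diagonal }\delta\Bigr\}.$$ For $I\subseteq[n]$ let $z_I=\min\{\sum_{i\in I}x_i : x\in \mathrm{As}^c_{n-1}\}$ be the tight right-hand side and let $y_I=\sum_{J\subseteq I}(-1)^{|I\setminus J|}z_J$. For non-empty $I$ this is the coefficient of the face $\Delta_I=\operatorname{conv}\{e_i : i\in I\}$ of the standard simplex in the decomposition $\mathrm{As}^c_{n-1}=\sum_{\varnothing\ne I\subseteq[n]}y_I\Delta_I$ as a Minkowski sum and difference (the terms with negative $y_I$ being moved to the other side). *The up and down interval decomposition.* For $a<b$ in $\overline{\mathrm D}_c$ let $(a,b)_{\mathrm D}=\{d\in \mathrm D_c: a<d<b\}$ (a down interval), and for $\alpha\le\beta$ in $\mathrm U_c$ let $[\alpha,\beta]_{\mathrm U}=\{u\in \mathrm U_c:\alpha\le u\le\beta\}$ (an up interval); empty down intervals with different end-points are considered distinct. Let $I\subseteq[n]$ be non-empty. 1. Take all non-empty inclusion-maximal down intervals $(a,b)_{\mathrm D}\subseteq I$, together with all empty down intervals $(d,d')_{\mathrm D}$, where $d<d'$ are consecutive elements of $\mathrm D_c$, such that each of the former intervals $(a,b)_{\mathrm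 D}$ satisfies $b\le d$ or $d'\le a$. 2. The up intervals of the decomposition are those up intervals contained in $I$ that are contained in, and inclusion-maximal within, the open interval $\{i\in[n]: a<i<b\}$ for some down interval $(a,b)_{\mathrm D}$ from step 1. 3. The down intervals of the decomposition are the non-empty ones from step 1, and those empty ones $(d,d')_{\mathrm D}$ from step 1 for which some up interval from step 2 is contained in $\{i\in[n]: d<i<d'\}$. The decomposition has type $(v_I,w_I)$ if it consists of $v_I$ down intervals and $w_I$ up intervals; $v_I$ is also the number of nested components of $I$. **Corollary.** For every non-empty $I\subseteq[n]$, one has $y_I=0$ if and only if the up and down interval decomposition of $I$ has type $(v_I,w_I)$ with $v_I>1$, or $n=3$ and $I=\mathrm U_c=\{2\}$. This holds for $y_I$ given by the alternating sum above, and for the coefficients $y_I$ in any decomposition of $\mathrm{As}^c_{n-1}$ into dilated faces $\Delta_I$ ($\varnothing\ne I\subseteq[n]$) as a Minkowski sum and difference. -/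

import Mathlib

open scoped Pointwise

/-! Throughout, a partition `[n] = D ⊔ U` with `1, n ∈ D` is given by its up set
`U ⊆ {2, …, n - 1}`; the down set is the complement of `U` in `[n] = {1, …, n}`. -/

namespace Assoc

/-! ### The labelled polygon -/

/-- The down set `D = [n] \ U`. -/
def downSet (n : ℕ) (U : Finset ℕ) : Finset ℕ := Finset.Icc 1 n \ U

/-- The extended down set `D ∪ {0, n + 1}`. -/
def downBar (n : ℕ) (U : Finset ℕ) : Finset ℕ := insert 0 (insert (n + 1) (downSet n U))

/-- Position of the label `x ∈ {0, …, n + 1}` on the boundary of the `(n + 2)`-gon `Q`, counted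
counter-clockwise from the vertex labelled `0`: first come the labels `0 = d₀ < d₁ < ⋯ < n + 1` of
the extended down set in increasing order, then the up labels in decreasing order. -/
def pos (n : ℕ) (U : Finset ℕ) (x : ℕ) : ℕ :=
  if x ∈ U then (downBar n U).card + (U.filter (fun u => x < u)).card
  else ((downBar n U).filter (fun d => d < x)).card

/-- Number of edges of the counter-clockwise boundary path of `Q` from label `a` to label `b`. -/
def ccwDist (n : ℕ) (U : Finset ℕ) (a b : ℕ) : ℕ :=
  (pos n U b + (n + 2) - pos n U a) % (n + 2)

/-- `{a, b}` with `a < b` is a proper diagonal of `Q`: its end-points are distinct vertices that are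
not adjacent on the boundary. -/
def IsProperDiagonal (n : ℕ) (U : Finset ℕ) (a b : ℕ) : Prop :=
  a < b ∧ b ≤ n + 1 ∧ ccwDist n U a b ≠ 1 ∧ ccwDist n U b a ≠ 1

/-- The labels strictly to the right of the diagonal oriented from `a` to `b`, that is, those met
strictly between `a` and `b` when going counter-clockwise from `a` to `b`. -/
def rightSide (n : ℕ) (U : Finset ℕ) (a b : ℕ) : Finset ℕ :=
  (Finset.range (n + 2)).filter (fun x => 0 < ccwDist n U a x ∧ ccwDist n U a x < ccwDist n U a b)

/-- The set `R_δ` of `δ = {a, b}`, `a < b`: in the right side of `δ`, oriented from `a` to `b`, the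
label `0` (respectively `n + 1`) is replaced by the smaller (respectively larger) label among the
end-points of `δ` that are contained in `U`, if there is one. -/
def R (n : ℕ) (U : Finset ℕ) (a b : ℕ) : Finset ℕ :=
  (rightSide n U a b).image (fun x =>
    if x = 0 then (if a ∈ U then a else if b ∈ U then b else x)
    else if x = n + 1 then (if b ∈ U then b else if a ∈ U then a else x)
    else x)

/-! ### The associahedron, its tight values and Minkowski coefficients -/

/-- `∑_{i ∈ I} x_i` for `I ⊆ {1, …, n}`; the coordinate `x_k`, for a label `k` in
`{1, …, n}`, is the value of `x` at the element `k - 1` of `Fin n`. -/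
noncomputable def coordSum (n : ℕ) (I : Finset ℕ) (x : Fin n → ℝ) : ℝ :=
  ∑ i : Fin n, if (i : ℕ) + 1 ∈ I then x i else 0

/-- The associahedron in `ℝⁿ` with the standard right-hand sides: one equation for `[n]`, and one
inequality for each proper diagonal of `Q`. -/
def associahedron (n : ℕ) (U : Finset ℕ) : Set (Fin n → ℝ) :=
  {x | coordSum n (Finset.Icc 1 n) x = (n : ℝ) * (n + 1) / 2 ∧
    ∀ a b : ℕ, IsProperDiagonal n U a b →
      ((R n U a b).card : ℝ) * ((R n U a b).card + 1) / 2 ≤ coordSum n (R n U a b) x}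

/-- The tight value `z_I`: the minimum of `∑_{i ∈ I} x_i` over the associahedron (which is a
non-empty compact polytope, so that this infimum is attained). -/
noncomputable def tightValue (n : ℕ) (U : Finset ℕ) (I : Finset ℕ) : ℝ :=
  sInf (coordSum n I '' associahedron n U)

/-- `y_I = ∑_{J ⊆ I} (-1)^{|I \ J|} z_J`, the Möbius inverse of the tight values. -/
noncomputable def minkowskiCoeff (n : ℕ) (U : Finset ℕ) (I : Finset ℕ) : ℝ :=
  ∑ J ∈ I.powerset, (-1 : ℝ) ^ (I \ J).card * tightValue n U J

/-- The face `Δ_I = conv {e_i | i ∈ I}` of the standard simplex in `ℝⁿ`. -/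
def simplexFace (n : ℕ) (I : Finset ℕ) : Set (Fin n → ℝ) :=
  convexHull ℝ {x | ∃ i : Fin n, (i : ℕ) + 1 ∈ I ∧ x = Pi.single i 1}

/-- `P = ∑_{∅ ≠ I ⊆ [n]} y_I Δ_I` as a Minkowski sum and difference: the faces with negative
coefficients are moved to the left-hand side (`A - B = P` means `A = P + B`). -/
def IsMinkowskiDecomposition (n : ℕ) (P : Set (Fin n → ℝ)) (y : Finset ℕ → ℝ) : Prop :=
  P + ∑ I ∈ (Finset.Icc 1 n).powerset.erase ∅, max (-(y I)) 0 • simplexFace n I =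
    ∑ I ∈ (Finset.Icc 1 n).powerset.erase ∅, max (y I) 0 • simplexFace n I

/-! ### The up and down interval decomposition -/

/-- The open down interval `(a, b)_D = {d ∈ D | a < d < b}`, where `p = (a, b)`. Down intervals are
given by their pair of end-points in the extended down set, so that empty down intervals with
different end-points are distinguished. -/
def downInt (n : ℕ) (U : Finset ℕ) (p : ℕ × ℕ) : Finset ℕ :=
  (downSet n U).filter (fun d => p.1 < d ∧ d < p.2)

/-- The closed up interval `[α, β]_U = {u ∈ U | α ≤ u ≤ β}`, where `p = (α, β)`. -/
def upInt (U : Finset ℕ) (p : ℕ × ℕ) : Finset ℕ :=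
  U.filter (fun u => p.1 ≤ u ∧ u ≤ p.2)

/-- The non-empty inclusion-maximal down intervals of `I`. -/
def maxDownInts (n : ℕ) (U I : Finset ℕ) : Finset (ℕ × ℕ) :=
  (downBar n U ×ˢ downBar n U).filter (fun p =>
    (downInt n U p).Nonempty ∧ downInt n U p ⊆ I ∧
    ∀ q ∈ downBar n U ×ˢ downBar n U, downInt n U q ⊆ I →
      downInt n U p ⊆ downInt n U q → downInt n U q = downInt n U p)

/-- The empty down intervals `(d_r, d_{r+1})_D`, with consecutive `d_r < d_{r+1}` in `D`, that lie
in the gaps before, between and after the non-empty inclusion-maximal down intervals of `I`. -/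
def emptyDownInts (n : ℕ) (U I : Finset ℕ) : Finset (ℕ × ℕ) :=
  (downSet n U ×ˢ downSet n U).filter (fun p =>
    p.1 < p.2 ∧ downInt n U p = ∅ ∧ ∀ q ∈ maxDownInts n U I, q.2 ≤ p.1 ∨ p.2 ≤ q.1)

/-- The up intervals of the decomposition: those up intervals of `I` that are contained in, and
inclusion-maximal within, the open interval `(a, b)` of `[n]` for some down interval `(a, b)_D` of
the above two kinds. -/
def upParts (n : ℕ) (U I : Finset ℕ) : Finset (ℕ × ℕ) :=
  (U ×ˢ U).filter (fun p => p.1 ≤ p.2 ∧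
    ∃ E ∈ maxDownInts n U I ∪ emptyDownInts n U I,
      upInt U p ⊆ I ∩ Finset.Ioo E.1 E.2 ∧
      ∀ q ∈ U ×ˢ U, upInt U q ⊆ I ∩ Finset.Ioo E.1 E.2 →
        upInt U p ⊆ upInt U q → upInt U q = upInt U p)

/-- The down intervals of the decomposition: the non-empty inclusion-maximal down intervals of `I`,
and those empty down intervals `(d_r, d_{r+1})_D` for which the open interval `(d_r, d_{r+1})`
contains one of the up intervals of the decomposition. -/
def downParts (n : ℕ) (U I : Finset ℕ) : Finset (ℕ × ℕ) :=
  maxDownInts n U I ∪ (emptyDownInts n U I).filter (fun E =>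
    ∃ p ∈ upParts n U I, upInt U p ⊆ Finset.Ioo E.1 E.2)

/-- The up and down interval decomposition of `I` has type `(v, w)`: it consists of `v` down
intervals and `w` up intervals. -/
def HasUpDownType (n : ℕ) (U I : Finset ℕ) (v w : ℕ) : Prop :=
  (downParts n U I).card = v ∧ (upParts n U I).card = w

end Assoc

namespace Assoc
open Finset

variable {n : ℕ} {U : Finset ℕ}

/-! ### Right sides of diagonals -/

/-! The tight values have a closed form. Attach to `I` the path that visits, in increasing order,
`0`, `n + 1`, the down labels outside `I` and the up labels in `I`. The sum of `x` over `R s t`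
splits into a term in `s` and a term in `t` (`sum_R`). Adding up along the path therefore
telescopes: `∑_I x` is the sum of the segment sums `∑_{R s t} x`, minus the total once for each up
label on the path (`sum_eq_pathSum`). The defining inequalities then bound `∑_I x` below by
`pathValue`. Conversely, `pathValue` is supermodular and takes the prescribed values at `∅`, `[n]`
and every `R a b`, so a greedily built point of its base polytope lies in the associahedron and
attains the bound (`isLeast_coordSum_associahedron`).

Let `m < M` be the extreme elements of `I`. Then `y_I` is an alternating sum, over `K ⊆ I \ {m, M}`,
of second differences of `pathValue` in the directions `m` and `M`. Such a difference is zero once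
the path of `K` has a label strictly between `m` and `M`; otherwise it is a product of one factor
for each end. A down label outside `I` between `m` and `M` lies on all these paths, so `y_I = 0`. If
there is none, exactly one `K` has a path avoiding the gap, and its term is non-zero
(`moebiusInv_pathValue_of_lt`). Singletons are computed directly and produce the exceptional case.

On the combinatorial side, the down intervals of the decomposition are the gaps between consecutive
extended down labels outside `I` that contain an element of `I` (`mem_downParts`). There are at
least two exactly when a down label outside `I` separates two elements of `I`. The coefficients of
any Minkowski decomposition are forced, because minima of linear functionals add
(`coeff_eq_moebiusInv`). -/

lemma downBar_eq (hU : U ⊆ Ioo 1 n) : downBar n U = range (n + 2) \ U := by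
  ext x
  have := @hU x
  simp only [downBar, downSet, mem_insert, mem_sdiff, mem_Icc, mem_range, mem_Ioo] at *
  grind

lemma mem_downBar (hU : U ⊆ Ioo 1 n) {x : ℕ} : x ∈ downBar n U ↔ x ≤ n + 1 ∧ x ∉ U := by
  rw [downBar_eq hU, mem_sdiff, mem_range]; grind

lemma card_downBar (hU : U ⊆ Ioo 1 n) : (downBar n U).card + U.card = n + 2 := by
  rw [downBar_eq hU, card_sdiff_add_card_eq_card, card_range]
  intro x hx
  have := hU hx
  simp only [mem_Ioo, mem_range] at *
  omega

lemma pos_lt_pos_of_notMem (hU : U ⊆ Ioo 1 n) {x y : ℕ} (hx : x ∉ U) (hy : y ∉ U) (hxy : x < y)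
    (hyn : y ≤ n + 1) : pos n U x < pos n U y := by
  rw [pos, pos, if_neg hx, if_neg hy]
  apply card_lt_card
  rw [ssubset_iff_of_subset (fun d => by simp only [mem_filter]; grind)]
  exact ⟨x, by simp [mem_downBar hU, hx, hxy]; omega, by simp⟩

lemma pos_lt_card (hU : U ⊆ Ioo 1 n) {x : ℕ} (hx : x ∉ U) (hxn : x ≤ n + 1) :
    pos n U x < (downBar n U).card := by
  rw [pos, if_neg hx]
  apply card_lt_card
  rw [ssubset_iff_of_subset (filter_subset _ _)]
  exact ⟨x, by simp [mem_downBar hU, hx]; omega, by simp⟩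

lemma card_le_pos {x : ℕ} (hx : x ∈ U) : (downBar n U).card ≤ pos n U x := by
  rw [pos, if_pos hx]; omega

lemma pos_lt_pos_of_mem {x y : ℕ} (hx : x ∈ U) (hy : y ∈ U) (hxy : x < y) :
    pos n U y < pos n U x := by
  rw [pos, pos, if_pos hx, if_pos hy]
  apply Nat.add_lt_add_left
  apply card_lt_card
  rw [ssubset_iff_of_subset (fun d => by simp only [mem_filter]; grind)]
  exact ⟨y, by simp [hy, hxy], by simp⟩

lemma pos_lt (hU : U ⊆ Ioo 1 n) {x : ℕ} (hxn : x ≤ n + 1) : pos n U x < n + 2 := by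
  have hc := card_downBar hU
  by_cases hx : x ∈ U
  · rw [pos, if_pos hx, ← hc]
    apply Nat.add_lt_add_left
    apply card_lt_card
    rw [ssubset_iff_of_subset (filter_subset _ _)]
    exact ⟨x, hx, by simp⟩
  · have := pos_lt_card hU hx hxn
    omega

lemma ccwDist_eq (hU : U ⊆ Ioo 1 n) {a b : ℕ} (ha : a ≤ n + 1) (hb : b ≤ n + 1) :
    ccwDist n U a b = if pos n U a ≤ pos n U b then pos n U b - pos n U a
      else pos n U b + (n + 2) - pos n U a := by
  have h1 := pos_lt hU ha
  have h2 := pos_lt hU hb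
  rw [ccwDist]
  split_ifs with h
  · rw [show pos n U b + (n + 2) - pos n U a = pos n U b - pos n U a + (n + 2) by omega,
      Nat.add_mod_right, Nat.mod_eq_of_lt (by omega)]
  · exact Nat.mod_eq_of_lt (by omega)

lemma pos_lt_pos_iff (hU : U ⊆ Ioo 1 n) {x y : ℕ} (hx : x ≤ n + 1) (hy : y ≤ n + 1) :
    pos n U x < pos n U y ↔
      (x ∉ U ∧ y ∈ U) ∨ (x ∉ U ∧ y ∉ U ∧ x < y) ∨ (x ∈ U ∧ y ∈ U ∧ y < x) := by
  have key : ∀ {x y : ℕ}, x ≤ n + 1 → y ≤ n + 1 →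
      (x ∉ U ∧ y ∈ U) ∨ (x ∉ U ∧ y ∉ U ∧ x < y) ∨ (x ∈ U ∧ y ∈ U ∧ y < x) →
      pos n U x < pos n U y := by
    rintro x y hx hy (⟨h1, h2⟩ | ⟨h1, h2, h3⟩ | ⟨h1, h2, h3⟩)
    · exact (pos_lt_card hU h1 hx).trans_le (card_le_pos h2)
    · exact pos_lt_pos_of_notMem hU h1 h2 h3 hy
    · exact pos_lt_pos_of_mem h2 h1 h3
  refine ⟨fun h => ?_, key hx hy⟩
  have := @key y x hy hx
  rcases eq_or_ne x y with rfl | hne <;> grind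

lemma mem_rightSide (hU : U ⊆ Ioo 1 n) {a b x : ℕ} (hab : a < b) (hb : b ≤ n + 1) :
    x ∈ rightSide n U a b ↔ x ≤ n + 1 ∧
      ((x ∉ U ∧ (a ∉ U → a < x) ∧ (b ∉ U → x < b)) ∨
        (x ∈ U ∧ ((a ∈ U ∧ x < a) ∨ (b ∈ U ∧ b < x)))) := by
  rw [rightSide, mem_filter, mem_range]
  by_cases hx : x ≤ n + 1
  swap
  · exact ⟨fun h => by omega, fun h => by omega⟩
  have ha : a ≤ n + 1 := by omega
  rw [ccwDist_eq hU ha hx, ccwDist_eq hU ha hb]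
  have h1 := pos_lt_pos_iff hU ha hx
  have h2 := pos_lt_pos_iff hU hx hb
  have h3 := pos_lt_pos_iff hU ha hb
  have h4 := pos_lt_pos_iff hU hx ha
  have h5 := pos_lt_pos_iff hU hb hx
  have h6 := pos_lt_pos_iff hU hb ha
  have p1 := pos_lt hU ha
  have p2 := pos_lt hU hb
  have p3 := pos_lt hU hx
  -- Cyclic betweenness in plain positions: the boundary path from `a` to `b` passes the starting
  -- vertex exactly when `pos b < pos a`.
  have e : (0 < (if pos n U a ≤ pos n U x then pos n U x - pos n U a
      else pos n U x + (n + 2) - pos n U a) ∧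
      (if pos n U a ≤ pos n U x then pos n U x - pos n U a
      else pos n U x + (n + 2) - pos n U a) < (if pos n U a ≤ pos n U b then pos n U b - pos n U a
      else pos n U b + (n + 2) - pos n U a)) ↔
      (pos n U a < pos n U x ∧ pos n U x < pos n U b) ∨
      (pos n U b < pos n U a ∧ (pos n U a < pos n U x ∨ pos n U x < pos n U b)) := by
    split_ifs <;> omega
  rw [e, h1, h2, h6]
  clear e h1 h2 h3 h4 h5 h6 p1 p2 p3
  grind

/-- Replacing `0` and `n + 1` by the up end-points turns the strict inequalities for up labels into
weak ones. The conditions imposed by `a` and by `b` are thereby decoupled. -/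
lemma mem_R (hU : U ⊆ Ioo 1 n) {a b i : ℕ} (hab : a < b) (hb : b ≤ n + 1) :
    i ∈ R n U a b ↔ (1 ≤ i ∧ i ≤ n) ∧
      ((i ∉ U ∧ (a ∉ U → a < i) ∧ (b ∉ U → i < b)) ∨
        (i ∈ U ∧ ((a ∈ U ∧ i ≤ a) ∨ (b ∈ U ∧ b ≤ i)))) := by
  have hU' : ∀ x ∈ U, 1 < x ∧ x < n := fun x hx => by simpa using hU hx
  rw [R, mem_image]
  simp only [mem_rightSide hU hab hb]
  constructor
  · rintro ⟨x, hx, rfl⟩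
    grind
  · rintro ⟨h1, h2⟩
    have h0 : 0 ∉ U := fun h => by have := hU' _ h; omega
    have hn1 : n + 1 ∉ U := fun h => by have := hU' _ h; omega
    by_cases hia : i = a ∧ a ∈ U
    · exact ⟨0, by grind, by grind⟩
    by_cases hib : i = b ∧ b ∈ U
    · exact ⟨n + 1, by grind, by grind⟩
    exact ⟨i, by grind, by grind⟩

lemma R_subset (hU : U ⊆ Ioo 1 n) {a b : ℕ} (hab : a < b) (hb : b ≤ n + 1) :
    R n U a b ⊆ Icc 1 n := fun i hi => by
  rw [mem_R hU hab hb] at hi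
  simpa using hi.1

/-- Boundary edges yield only degenerate sets, for which the inequality of the associahedron is an
automatic equality. Segments of a path thus need not be proper diagonals. -/
lemma R_eq_of_not_isProperDiagonal (hU : U ⊆ Ioo 1 n) {a b : ℕ} (hab : a < b) (hb : b ≤ n + 1)
    (h : ¬ IsProperDiagonal n U a b) : R n U a b = ∅ ∨ R n U a b = Icc 1 n := by
  have h' : ccwDist n U a b = 1 ∨ ccwDist n U b a = 1 := by
    by_contra! h'
    exact h ⟨hab, hb, h'.1, h'.2⟩
  have hU' : ∀ x ∈ U, 1 < x ∧ x < n := fun x hx => by simpa using hU hx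
  rcases h' with h' | h'
  · left
    rw [R, image_eq_empty, rightSide, filter_eq_empty_iff]
    intro x _
    omega
  · right
    have ha : a ≤ n + 1 := by omega
    rw [ccwDist_eq hU hb ha] at h'
    -- When `a` immediately follows `b` on the boundary, no vertex lies strictly between them there.
    -- This is applied to `i`, `0` and `n + 1`.
    have hcyc : ∀ x ≤ n + 1, ¬ (pos n U b < pos n U x ∧ pos n U x < pos n U a) ∧
        (pos n U a < pos n U b → ¬ pos n U x < pos n U a ∧ ¬ pos n U b < pos n U x) := by
      intro x hx
      have p1 := pos_lt hU ha
      have p2 := pos_lt hU hb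
      have p3 := pos_lt hU hx
      split_ifs at h' <;> omega
    have h6 := pos_lt_pos_iff hU ha hb
    have h0 : 0 ∉ U := fun h => by have := hU' _ h; omega
    have hn1 : n + 1 ∉ U := fun h => by have := hU' _ h; omega
    ext i
    rw [mem_R hU hab hb, mem_Icc, and_iff_left_iff_imp]
    rintro ⟨hi1, hi2⟩
    have hi : i ≤ n + 1 := by omega
    have hc := hcyc i hi
    have hc0 := hcyc 0 (by omega)
    have hcn := hcyc (n + 1) le_rfl
    rw [pos_lt_pos_iff hU hb hi, pos_lt_pos_iff hU hi ha, pos_lt_pos_iff hU ha hb] at hc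
    rw [pos_lt_pos_iff hU hb (by omega), pos_lt_pos_iff hU (by omega) ha,
      pos_lt_pos_iff hU ha hb] at hc0 hcn
    by_cases c1 : a ∈ U <;> by_cases c2 : b ∈ U <;> by_cases c3 : i ∈ U <;>
      simp only [c1, c2, c3, h0, hn1, true_and, false_and, and_true, and_false, not_true,
        not_false_eq_true, or_false, false_or, forall_true_left, false_imp_iff] at * <;> grind

/-! ### Sums over consecutive elements -/

/-- The pairs of consecutive elements of `S`. -/
def consecPairs (S : Finset ℕ) : Finset (ℕ × ℕ) :=
  (S ×ˢ S).filter (fun p => p.1 < p.2 ∧ ∀ r ∈ S, ¬ (p.1 < r ∧ r < p.2))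

lemma mem_consecPairs {S : Finset ℕ} {p q : ℕ} : (p, q) ∈ consecPairs S ↔
    p ∈ S ∧ q ∈ S ∧ p < q ∧ ∀ r ∈ S, ¬ (p < r ∧ r < q) := by
  simp only [consecPairs, mem_filter, mem_product, and_assoc]

/-- The sum of `G s t` over the pairs `(s, t)` of consecutive elements of `S`. -/
def pathSum (G : ℕ → ℕ → ℝ) (S : Finset ℕ) : ℝ := ∑ p ∈ consecPairs S, G p.1 p.2

lemma consecPairs_insert {S : Finset ℕ} {p q i : ℕ} (h : (p, q) ∈ consecPairs S)
    (hpi : p < i) (hiq : i < q) :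
    consecPairs (insert i S) = insert (p, i) (insert (i, q) ((consecPairs S).erase (p, q))) := by
  rw [mem_consecPairs] at h
  obtain ⟨hp, hq, hpq, hr⟩ := h
  ext ⟨a, b⟩
  simp only [mem_consecPairs, mem_insert, mem_erase, Prod.mk.injEq, ne_eq, forall_eq_or_imp]
  grind

lemma pathSum_insert (G : ℕ → ℕ → ℝ) {S : Finset ℕ} {p q i : ℕ} (h : (p, q) ∈ consecPairs S)
    (hpi : p < i) (hiq : i < q) :
    pathSum G (insert i S) = pathSum G S - G p q + G p i + G i q := by
  have hi : i ∉ S := fun hi => (mem_consecPairs.1 h).2.2.2 i hi ⟨hpi, hiq⟩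
  have h1 : (i, q) ∉ (consecPairs S).erase (p, q) := fun h' =>
    hi (mem_consecPairs.1 (mem_of_mem_erase h')).1
  have h2 : (p, i) ∉ insert (i, q) ((consecPairs S).erase (p, q)) := by
    rw [mem_insert, Prod.mk.injEq]
    rintro (h' | h')
    · omega
    · exact hi (mem_consecPairs.1 (mem_of_mem_erase h')).2.1
  rw [pathSum, consecPairs_insert h hpi hiq, sum_insert h2, sum_insert h1, pathSum,
    ← add_sum_erase _ _ h]
  ring

lemma exists_consecPair {S : Finset ℕ} {i : ℕ} (hi : i ∉ S) (h0 : ∃ a ∈ S, a < i)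
    (h1 : ∃ b ∈ S, i < b) : ∃ p q, (p, q) ∈ consecPairs S ∧ p < i ∧ i < q := by
  have e0 : (S.filter (· < i)).Nonempty := by
    obtain ⟨a, h⟩ := h0; exact ⟨a, by simpa using h⟩
  have e1 : (S.filter (i < ·)).Nonempty := by
    obtain ⟨a, h⟩ := h1; exact ⟨a, by simpa using h⟩
  obtain ⟨p, hp, hp'⟩ := exists_max_image _ id e0
  obtain ⟨q, hq, hq'⟩ := exists_min_image _ id e1
  simp only [mem_filter, id] at *
  refine ⟨p, q, mem_consecPairs.2 ⟨hp.1, hq.1, by omega, fun r hr h => ?_⟩, hp.2, hq.2⟩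
  rcases lt_trichotomy r i with h' | rfl | h'
  · have := hp' r ⟨hr, h'⟩; omega
  · exact hi hr
  · have := hq' r ⟨hr, h'⟩; omega

/-- Both insertions happen inside the single gap `(p, q)`, so all other segments cancel. -/
lemma pathSum_secondDiff (G : ℕ → ℕ → ℝ) {W : Finset ℕ} {p q i j : ℕ}
    (h : (p, q) ∈ consecPairs W) (hpi : p < i) (hij : i < j) (hjq : j < q) :
    pathSum G (insert j (insert i W)) - pathSum G (insert i W) - pathSum G (insert j W)
      + pathSum G W = G i j + G p q - G i q - G p j := by
  have h' : (i, q) ∈ consecPairs (insert i W) := by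
    rw [consecPairs_insert h hpi (hij.trans hjq)]; simp
  rw [pathSum_insert G h' hij hjq, pathSum_insert G h (hpi.trans hij) hjq]
  ring

/-- The vertex `r` keeps the gap around `i` unaffected by `j`, so inserting `i` changes the sum by
the same amount with or without `j`. -/
lemma pathSum_secondDiff_eq_zero (G : ℕ → ℕ → ℝ) {W : Finset ℕ} {r i j : ℕ}
    (hi : i ∉ W) (h0 : ∃ a ∈ W, a < i) (hir : i < r) (hrj : r < j) (hr : r ∈ W) :
    pathSum G (insert j (insert i W)) - pathSum G (insert i W) - pathSum G (insert j W)
      + pathSum G W = 0 := by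
  obtain ⟨p, q, h, hpi, hiq⟩ := exists_consecPair hi h0 ⟨r, hr, hir⟩
  have h' : (p, q) ∈ consecPairs (insert j W) := by
    rw [mem_consecPairs] at h ⊢
    have := h.2.2.2 r hr
    simp only [mem_insert]
    grind
  rw [insert_comm, pathSum_insert G h' hpi hiq, pathSum_insert G h hpi hiq]
  ring

/-- Each interior vertex ends one segment and starts the next. -/
lemma pathSum_separable (α β : ℕ → ℝ) (T : Finset ℕ) {N : ℕ} (hT : T ⊆ Ioo 0 N) (hN : 0 < N) :
    pathSum (fun s t => α t + β s) (insert 0 (insert N T)) =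
      α N + β 0 + ∑ i ∈ T, (α i + β i) := by
  induction T using Finset.induction_on with
  | empty =>
    have : consecPairs (insert 0 (insert N ∅)) = {(0, N)} := by
      ext ⟨a, b⟩
      simp only [mem_consecPairs, mem_insert, mem_singleton, Prod.mk.injEq, notMem_empty]
      grind
    rw [pathSum, this]
    simp
  | insert i T hi ih =>
    rw [insert_subset_iff, mem_Ioo] at hT
    have hi' : i ∉ insert 0 (insert N T) := by
      simp only [mem_insert, hi, or_false]; omega
    obtain ⟨p, q, h, hpi, hiq⟩ := exists_consecPair hi' ⟨0, by simp, hT.1.1⟩ ⟨N, by simp, hT.1.2⟩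
    rw [insert_comm N i, insert_comm 0 i, pathSum_insert _ h hpi hiq, ih hT.2, sum_insert hi]
    ring

/-! ### Supermodular functions -/

lemma marginal_le_of_supermodular {f : Finset ℕ → ℝ} {V : Finset ℕ}
    (hf : ∀ I ⊆ V, ∀ i ∈ V, ∀ j ∈ V, i ∉ I → j ∉ I → i ≠ j →
      f (insert i I) + f (insert j I) ≤ f (insert j (insert i I)) + f I)
    {J B : Finset ℕ} {a : ℕ} (ha : a ∈ V) (hd : Disjoint J B) (haJ : a ∉ J) (haB : a ∉ B)
    (hV : J ∪ B ⊆ V) : f (insert a J) - f J ≤ f (insert a (J ∪ B)) - f (J ∪ B) := by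
  induction B using Finset.induction_on with
  | empty => simp
  | insert b B hb ih =>
    simp only [disjoint_insert_right, mem_insert, not_or, union_insert, insert_subset_iff] at *
    have h1 := ih hd.2 haB.2 hV.2
    have h2 := hf (J ∪ B) hV.2 b hV.1 a ha (by simp [hb, hd.1]) (by simp [haJ, haB.2]) (Ne.symm haB.1)
    linarith

/-- Greedy algorithm: each new coordinate is the marginal gain of `f`. Marginals grow with the set,
so this gain also suffices for every smaller set containing the new element. -/
lemma exists_extension_of_supermodular {f : Finset ℕ → ℝ} {V : Finset ℕ}
    (hf : ∀ I ⊆ V, ∀ i ∈ V, ∀ j ∈ V, i ∉ I → j ∉ I → i ≠ j →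
      f (insert i I) + f (insert j I) ≤ f (insert j (insert i I)) + f I)
    {I B : Finset ℕ} (hd : Disjoint I B) (hV : I ∪ B ⊆ V) {x : ℕ → ℝ}
    (hx : ∀ J ⊆ I, f J ≤ ∑ i ∈ J, x i) (hxI : ∑ i ∈ I, x i = f I) :
    ∃ x' : ℕ → ℝ, (∀ J ⊆ I ∪ B, f J ≤ ∑ i ∈ J, x' i) ∧ ∑ i ∈ I, x' i = f I ∧
      ∑ i ∈ I ∪ B, x' i = f (I ∪ B) := by
  induction B using Finset.induction_on with
  | empty => exact ⟨x, by simpa using hx, hxI, by simpa using hxI⟩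
  | insert b B hb ih =>
    simp only [disjoint_insert_right, union_insert, insert_subset_iff] at *
    obtain ⟨x', h1, h2, h3⟩ := ih hd.2 hV.2
    have hbI : b ∉ I ∪ B := by simp [hb, hd.1]
    have hupd : ∀ J : Finset ℕ, b ∉ J → ∀ c : ℝ, ∑ i ∈ J, Function.update x' b c i = ∑ i ∈ J, x' i :=
      fun J hJ c => sum_congr rfl fun i hi =>
        Function.update_of_ne (by rintro rfl; exact hJ hi) _ _
    refine ⟨Function.update x' b (f (insert b (I ∪ B)) - f (I ∪ B)), fun J hJ => ?_, ?_, ?_⟩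
    · by_cases hbJ : b ∈ J
      · have hJ' : J.erase b ⊆ I ∪ B := by
          rwa [← subset_insert_iff]
        have key := marginal_le_of_supermodular hf (J := J.erase b) (B := (I ∪ B) \ J.erase b) hV.1
          disjoint_sdiff (notMem_erase b J) (fun h => hbI (mem_sdiff.1 h).1)
          (by rw [union_sdiff_of_subset hJ']; exact hV.2)
        rw [union_sdiff_of_subset hJ', insert_erase hbJ] at key
        rw [← insert_erase hbJ, sum_insert (notMem_erase b J), hupd _ (notMem_erase b J),
          Function.update_self, insert_erase hbJ]
        have := h1 _ hJ'
        linarith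
      · rw [hupd _ hbJ]
        exact h1 J ((subset_insert_iff_of_notMem hbJ).1 hJ)
    · rw [hupd _ hd.1, h2]
    · rw [sum_insert hbI, hupd _ hbI, Function.update_self, h3]
      ring

/-- A supermodular function on the subsets of `V` that vanishes at `∅` is attained at any given
`I ⊆ V` by a point of its base polytope. -/
lemma exists_base_of_supermodular {f : Finset ℕ → ℝ} {V : Finset ℕ} (h0 : f ∅ = 0)
    (hf : ∀ I ⊆ V, ∀ i ∈ V, ∀ j ∈ V, i ∉ I → j ∉ I → i ≠ j →
      f (insert i I) + f (insert j I) ≤ f (insert j (insert i I)) + f I)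
    {I : Finset ℕ} (hI : I ⊆ V) :
    ∃ x : ℕ → ℝ, (∀ J ⊆ V, f J ≤ ∑ i ∈ J, x i) ∧ ∑ i ∈ I, x i = f I ∧ ∑ i ∈ V, x i = f V := by
  -- The elements of `I` are added first, making `I` tight; the rest of `V` follows.
  obtain ⟨x, h1, -, h3⟩ := exists_extension_of_supermodular hf (I := ∅) (B := I) (x := 0)
    (disjoint_empty_left _) (by simpa using hI) (by simp [h0]) (by simp [h0])
  rw [empty_union] at h1 h3
  have := exists_extension_of_supermodular hf (I := I) (B := V \ I) (x := x)
    disjoint_sdiff (by rw [union_sdiff_of_subset hI]) h1 h3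
  rwa [union_sdiff_of_subset hI] at this

/-! ### The path formula for the tight values -/

/-- The contribution of the end-point `t` to `∑_{i ∈ R {s, t}} X i`, where `s < t`. -/
def upperPart (n : ℕ) (U : Finset ℕ) (X : ℕ → ℝ) (t : ℕ) : ℝ :=
  ∑ i ∈ Icc 1 n, if t ∈ U then (if i ∈ U ∧ i < t then 0 else X i)
    else (if i ∉ U ∧ i < t then X i else 0)

/-- The contribution of the end-point `s` to `∑_{i ∈ R {s, t}} X i`, where `s < t`. -/
def lowerPart (n : ℕ) (U : Finset ℕ) (X : ℕ → ℝ) (s : ℕ) : ℝ :=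
  ∑ i ∈ Icc 1 n, if s ∈ U then (if i ∈ U ∧ i ≤ s then X i else 0)
    else (if i ∉ U ∧ i ≤ s then -X i else 0)

/-- The end-point `t` fixes a preliminary set. The end-point `s` then adds the up labels `≤ s` or
removes the down labels `≤ s`; since `s < t`, the former were missing and the latter present. -/
lemma sum_R (hU : U ⊆ Ioo 1 n) (X : ℕ → ℝ) {s t : ℕ} (hst : s < t) (ht : t ≤ n + 1) :
    ∑ i ∈ R n U s t, X i = upperPart n U X t + lowerPart n U X s := by
  rw [upperPart, lowerPart, ← sum_add_distrib, ← inter_eq_right.2 (R_subset hU hst ht),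
    ← sum_ite_mem]
  refine sum_congr rfl fun i hi => ?_
  rw [mem_Icc] at hi
  simp only [mem_R hU hst ht]
  by_cases c1 : s ∈ U <;> by_cases c2 : t ∈ U <;> by_cases c3 : i ∈ U <;> grind

lemma card_R (hU : U ⊆ Ioo 1 n) {s t : ℕ} (hst : s < t) (ht : t ≤ n + 1) :
    ((R n U s t).card : ℝ) = upperPart n U 1 t + lowerPart n U 1 s := by
  rw [← sum_R hU 1 hst ht]; simp

/-- The triangular number `c (c + 1) / 2`. -/
noncomputable def tri (c : ℝ) : ℝ := c * (c + 1) / 2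

/-- The weight of a segment `(s, t)` of a path. -/
noncomputable def segWeight (n : ℕ) (U : Finset ℕ) (s t : ℕ) : ℝ :=
  tri (upperPart n U 1 t + lowerPart n U 1 s) - if s ∈ U then tri n else 0

/-- The labels on the path of `I`: the extended down labels outside of `I` and the up labels
in `I`. -/
def pathSet (n : ℕ) (U I : Finset ℕ) : Finset ℕ :=
  insert 0 (insert (n + 1) ((Icc 1 n).filter (fun k => k ∈ U ↔ k ∈ I)))

/-- The sum of the weights along the path of `I`. -/
noncomputable def pathValue (n : ℕ) (U I : Finset ℕ) : ℝ :=
  pathSum (segWeight n U) (pathSet n U I)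

lemma mem_pathSet {I : Finset ℕ} {k : ℕ} : k ∈ pathSet n U I ↔
    k = 0 ∨ k = n + 1 ∨ ((1 ≤ k ∧ k ≤ n) ∧ (k ∈ U ↔ k ∈ I)) := by
  simp [pathSet]

lemma le_of_mem_pathSet {I : Finset ℕ} {k : ℕ} (hk : k ∈ pathSet n U I) : k ≤ n + 1 := by
  rw [mem_pathSet] at hk; omega

lemma zero_mem_pathSet (I : Finset ℕ) : 0 ∈ pathSet n U I := by simp [pathSet]

lemma succ_mem_pathSet (I : Finset ℕ) : n + 1 ∈ pathSet n U I := by simp [pathSet]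

lemma upperPart_add_lowerPart_self (X : ℕ → ℝ) {i : ℕ} (hi : i ∈ Icc 1 n) :
    upperPart n U X i + (lowerPart n U X i - if i ∈ U then ∑ j ∈ Icc 1 n, X j else 0) =
      if i ∈ U then X i else -X i := by
  have h : (if i ∈ U then X i else -X i) =
      ∑ j ∈ Icc 1 n, if j = i then (if j ∈ U then X j else -X j) else 0 := by
    rw [sum_ite_eq' _ _ _, if_pos hi]
  rw [h, upperPart, lowerPart]
  split_ifs with hiU
  · rw [← sum_sub_distrib, ← sum_add_distrib]
    exact sum_congr rfl fun j _ => by grind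
  · rw [sub_zero, ← sum_add_distrib]
    exact sum_congr rfl fun j _ => by grind

/-- The end vertices contribute the sum over all down labels. Each interior down vertex, lying
outside `I`, subtracts its coordinate, and each up vertex, lying in `I`, adds its own. -/
lemma sum_eq_pathSum (hU : U ⊆ Ioo 1 n) (X : ℕ → ℝ) {I : Finset ℕ} (hI : I ⊆ Icc 1 n) :
    ∑ i ∈ I, X i = pathSum (fun s t => upperPart n U X t +
      (lowerPart n U X s - if s ∈ U then ∑ j ∈ Icc 1 n, X j else 0)) (pathSet n U I) := by
  have h0 : 0 ∉ U := fun h => by simpa using hU h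
  have hn1 : n + 1 ∉ U := fun h => by have := hU h; simp at this
  rw [pathSet, pathSum_separable (fun t => upperPart n U X t)
    (fun s => lowerPart n U X s - if s ∈ U then ∑ j ∈ Icc 1 n, X j else 0) _
    (fun i hi => by simp only [mem_filter, mem_Icc, mem_Ioo] at *; omega) (Nat.succ_pos n),
    sum_congr rfl fun i hi => upperPart_add_lowerPart_self X (mem_filter.1 hi).1,
    sum_filter, upperPart, lowerPart, if_neg h0, ← inter_eq_right.2 hI, ← sum_ite_mem]
  simp only [h0, hn1, if_false, sub_zero]
  rw [← sum_add_distrib, ← sum_add_distrib]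
  refine sum_congr rfl fun i hi => ?_
  rw [mem_Icc] at hi
  by_cases c1 : i ∈ U <;> by_cases c2 : i ∈ I <;> grind

lemma pathValue_le_sum (hU : U ⊆ Ioo 1 n) {X : ℕ → ℝ} {I : Finset ℕ} (hI : I ⊆ Icc 1 n)
    (htot : ∑ i ∈ Icc 1 n, X i = tri n)
    (hX : ∀ s t, IsProperDiagonal n U s t → tri (R n U s t).card ≤ ∑ i ∈ R n U s t, X i) :
    pathValue n U I ≤ ∑ i ∈ I, X i := by
  rw [sum_eq_pathSum hU X hI, pathValue]
  refine sum_le_sum fun ⟨s, t⟩ hst => ?_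
  rw [mem_consecPairs] at hst
  have ht := le_of_mem_pathSet hst.2.1
  have key : tri (R n U s t).card ≤ ∑ i ∈ R n U s t, X i := by
    by_cases hp : IsProperDiagonal n U s t
    · exact hX s t hp
    · rcases R_eq_of_not_isProperDiagonal hU hst.2.2.1 ht hp with h | h
      · rw [h]; simp [tri]
      · rw [h, htot]; simp
  rw [card_R hU hst.2.2.1 ht, sum_R hU X hst.2.2.1 ht] at key
  simp only [segWeight, htot]
  linarith

/-! ### Second differences and supermodularity of the path value -/

/-- The sign with which an element of `[n]` is toggled on the path. -/
def toggleSign (U : Finset ℕ) (i : ℕ) : ℝ := if i ∈ U then 1 else -1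

/-- Adding an up label to `I` inserts it into the path, while adding a down label deletes it. Each
down label therefore reverses the sign of the difference. -/
lemma pathValue_secondDiff {I : Finset ℕ} {i j : ℕ} (hi : i ∈ Icc 1 n) (hj : j ∈ Icc 1 n)
    (hiI : i ∉ I) (hjI : j ∉ I) (hij : i < j) (G : ℕ → ℕ → ℝ) (W : Finset ℕ)
    (hW : W = (pathSet n U I \ {i, j})) :
    pathSum G (pathSet n U (insert j (insert i I))) - pathSum G (pathSet n U (insert i I))
      - pathSum G (pathSet n U (insert j I)) + pathSum G (pathSet n U I) =
    toggleSign U i * toggleSign U j * (pathSum G (insert j (insert i W))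
      - pathSum G (insert i W) - pathSum G (insert j W) + pathSum G W) := by
  have key : ∀ {A B : Finset ℕ}, (∀ k, k ∈ A ↔ k ∈ B) → pathSum G A = pathSum G B :=
    fun h => by rw [Finset.ext h]
  rw [mem_Icc] at hi hj
  have hW' : ∀ k, k ∈ W ↔ k ∈ pathSet n U I ∧ k ≠ i ∧ k ≠ j := fun k => by simp [hW]
  simp only [mem_pathSet] at hW'
  rw [toggleSign, toggleSign]
  by_cases c1 : i ∈ U <;> by_cases c2 : j ∈ U
  · rw [key (A := pathSet n U (insert j (insert i I))) (B := insert j (insert i W))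
        (fun k => by simp only [mem_pathSet, mem_insert, hW']; grind),
      key (A := pathSet n U (insert i I)) (B := insert i W)
        (fun k => by simp only [mem_pathSet, mem_insert, hW']; grind),
      key (A := pathSet n U (insert j I)) (B := insert j W)
        (fun k => by simp only [mem_pathSet, mem_insert, hW']; grind),
      key (A := pathSet n U I) (B := W)
        (fun k => by simp only [mem_pathSet, hW']; grind), if_pos c1, if_pos c2]
    ring
  · rw [key (A := pathSet n U (insert j (insert i I))) (B := insert i W)
        (fun k => by simp only [mem_pathSet, mem_insert, hW']; grind),
      key (A := pathSet n U (insert i I)) (B := insert j (insert i W))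
        (fun k => by simp only [mem_pathSet, mem_insert, hW']; grind),
      key (A := pathSet n U (insert j I)) (B := W)
        (fun k => by simp only [mem_pathSet, mem_insert, hW']; grind),
      key (A := pathSet n U I) (B := insert j W)
        (fun k => by simp only [mem_pathSet, mem_insert, hW']; grind), if_pos c1, if_neg c2]
    ring
  · rw [key (A := pathSet n U (insert j (insert i I))) (B := insert j W)
        (fun k => by simp only [mem_pathSet, mem_insert, hW']; grind),
      key (A := pathSet n U (insert i I)) (B := W)
        (fun k => by simp only [mem_pathSet, mem_insert, hW']; grind),
      key (A := pathSet n U (insert j I)) (B := insert j (insert i W))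
        (fun k => by simp only [mem_pathSet, mem_insert, hW']; grind),
      key (A := pathSet n U I) (B := insert i W)
        (fun k => by simp only [mem_pathSet, mem_insert, hW']; grind), if_neg c1, if_pos c2]
    ring
  · rw [key (A := pathSet n U (insert j (insert i I))) (B := W)
        (fun k => by simp only [mem_pathSet, mem_insert, hW']; grind),
      key (A := pathSet n U (insert i I)) (B := insert j W)
        (fun k => by simp only [mem_pathSet, mem_insert, hW']; grind),
      key (A := pathSet n U (insert j I)) (B := insert i W)
        (fun k => by simp only [mem_pathSet, mem_insert, hW']; grind),
      key (A := pathSet n U I) (B := insert j (insert i W))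
        (fun k => by simp only [mem_pathSet, mem_insert, hW']; grind), if_neg c1, if_neg c2]
    ring

/-- A segment weight is a triangular number of (term in `t`) + (term in `s`), up to a function of
`s` alone. Only the cross term of the square survives, which gives the product. -/
lemma pathValue_secondDiff_eq {I : Finset ℕ} {i j p q : ℕ} (hi : i ∈ Icc 1 n) (hj : j ∈ Icc 1 n)
    (hiI : i ∉ I) (hjI : j ∉ I) (hij : i < j) (h : (p, q) ∈ consecPairs (pathSet n U I \ {i, j}))
    (hpi : p < i) (hjq : j < q) :
    pathValue n U (insert j (insert i I)) - pathValue n U (insert i I)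
      - pathValue n U (insert j I) + pathValue n U I =
    (toggleSign U i * (lowerPart n U 1 i - lowerPart n U 1 p)) *
      (toggleSign U j * (upperPart n U 1 j - upperPart n U 1 q)) := by
  rw [pathValue, pathValue, pathValue, pathValue, pathValue_secondDiff hi hj hiI hjI hij _ _ rfl,
    pathSum_secondDiff _ h hpi hij hjq]
  simp only [segWeight, tri]
  ring

lemma pathValue_secondDiff_eq_zero {I : Finset ℕ} {i j r : ℕ} (hi : i ∈ Icc 1 n)
    (hj : j ∈ Icc 1 n) (hiI : i ∉ I) (hjI : j ∉ I) (hir : i < r) (hrj : r < j)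
    (hr : r ∈ pathSet n U I) :
    pathValue n U (insert j (insert i I)) - pathValue n U (insert i I)
      - pathValue n U (insert j I) + pathValue n U I = 0 := by
  have hi' := mem_Icc.1 hi
  have hj' := mem_Icc.1 hj
  rw [pathValue, pathValue, pathValue, pathValue,
    pathValue_secondDiff hi hj hiI hjI (hir.trans hrj) _ _ rfl,
    pathSum_secondDiff_eq_zero (r := r) _ (by simp)
      ⟨0, by simp only [mem_sdiff, zero_mem_pathSet, mem_insert, mem_singleton, true_and]; omega,
        by omega⟩ hir hrj
      (by simp only [mem_sdiff, hr, mem_insert, mem_singleton, true_and]; omega), mul_zero]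

lemma toggleSign_mul_upperPart_nonneg {j t : ℕ} (hjt : j < t) :
    0 ≤ toggleSign U j * (upperPart n U 1 j - upperPart n U 1 t) := by
  rw [upperPart, upperPart, ← sum_sub_distrib, mul_sum, toggleSign]
  exact sum_nonneg fun i _ => by
    simp only [Pi.one_apply]
    split_ifs <;> first | (norm_num; done) | (exfalso; grind)

/-- No label contributes negatively, and `j` itself contributes `1`. -/
lemma toggleSign_mul_upperPart_pos {j t : ℕ} (hj : j ∈ Icc 1 n) (hjt : j < t) (ht : t ∉ U) :
    0 < toggleSign U j * (upperPart n U 1 j - upperPart n U 1 t) := by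
  rw [upperPart, upperPart, ← sum_sub_distrib, mul_sum, toggleSign]
  exact sum_pos' (fun i _ => by
    simp only [Pi.one_apply]
    split_ifs <;> first | (norm_num; done) | (exfalso; grind))
    ⟨j, hj, by
    simp only [Pi.one_apply]
    split_ifs <;> first | (norm_num; done) | (exfalso; grind)⟩

lemma toggleSign_mul_lowerPart_nonneg {i s : ℕ} (hsi : s < i) :
    0 ≤ toggleSign U i * (lowerPart n U 1 i - lowerPart n U 1 s) := by
  rw [lowerPart, lowerPart, ← sum_sub_distrib, mul_sum, toggleSign]
  exact sum_nonneg fun i _ => by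
    simp only [Pi.one_apply]
    split_ifs <;> first | (norm_num; done) | (exfalso; grind)

lemma toggleSign_mul_lowerPart_pos {i s : ℕ} (hi : i ∈ Icc 1 n) (hsi : s < i) (hs : s ∉ U) :
    0 < toggleSign U i * (lowerPart n U 1 i - lowerPart n U 1 s) := by
  rw [lowerPart, lowerPart, ← sum_sub_distrib, mul_sum, toggleSign]
  exact sum_pos' (fun i _ => by
    simp only [Pi.one_apply]
    split_ifs <;> first | (norm_num; done) | (exfalso; grind))
    ⟨i, hi, by
    simp only [Pi.one_apply]
    split_ifs <;> first | (norm_num; done) | (exfalso; grind)⟩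

lemma pathValue_supermodular_of_lt {I : Finset ℕ} {i j : ℕ} (hi : i ∈ Icc 1 n)
    (hj : j ∈ Icc 1 n) (hiI : i ∉ I) (hjI : j ∉ I) (hij : i < j) :
    pathValue n U (insert i I) + pathValue n U (insert j I) ≤
      pathValue n U (insert j (insert i I)) + pathValue n U I := by
  have hi' := mem_Icc.1 hi
  have hj' := mem_Icc.1 hj
  by_cases hr : ∃ r ∈ pathSet n U I, i < r ∧ r < j
  · obtain ⟨r, hr, hir, hrj⟩ := hr
    linarith [pathValue_secondDiff_eq_zero hi hj hiI hjI hir hrj hr]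
  · push Not at hr
    obtain ⟨p, q, h, hpi, hiq⟩ := exists_consecPair (S := pathSet n U I \ {i, j}) (i := i)
      (by simp)
      ⟨0, by simp only [mem_sdiff, zero_mem_pathSet, mem_insert, mem_singleton, true_and]; omega,
        by omega⟩
      ⟨n + 1, by simp only [mem_sdiff, succ_mem_pathSet, mem_insert, mem_singleton, true_and]; omega,
        by omega⟩
    have hjq : j < q := by
      have hq := (mem_consecPairs.1 h).2.1
      simp only [mem_sdiff, mem_insert, mem_singleton] at hq
      have := hr q hq.1 hiq
      omega
    have := mul_nonneg (toggleSign_mul_lowerPart_nonneg (n := n) (U := U) hpi)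
      (toggleSign_mul_upperPart_nonneg (n := n) (U := U) hjq)
    linarith [pathValue_secondDiff_eq hi hj hiI hjI hij h hpi hjq]

lemma pathValue_supermodular : ∀ I ⊆ Icc 1 n, ∀ i ∈ Icc 1 n, ∀ j ∈ Icc 1 n, i ∉ I → j ∉ I →
    i ≠ j → pathValue n U (insert i I) + pathValue n U (insert j I) ≤
      pathValue n U (insert j (insert i I)) + pathValue n U I := by
  intro I _ i hi j hj hiI hjI hij
  rcases lt_or_gt_of_ne hij with h | h
  · exact pathValue_supermodular_of_lt hi hj hiI hjI h
  · rw [add_comm, insert_comm]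
    exact pathValue_supermodular_of_lt hj hi hjI hiI h

/-! ### The path value at `∅`, at `[n]` and at the sets `R a b` -/

lemma pathSet_empty_gap (hU : U ⊆ Ioo 1 n) {s t : ℕ}
    (h : (s, t) ∈ consecPairs (pathSet n U ∅)) :
    s ∉ U ∧ upperPart n U 1 t + lowerPart n U 1 s = 0 := by
  have hU' : ∀ x ∈ U, 1 < x ∧ x < n := fun x hx => by simpa using hU hx
  rw [mem_consecPairs] at h
  obtain ⟨hs, ht, hst, hr⟩ := h
  have htn := le_of_mem_pathSet ht
  refine ⟨by rw [mem_pathSet] at hs; grind, ?_⟩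
  rw [← card_R hU hst htn, Nat.cast_eq_zero, card_eq_zero, eq_empty_iff_forall_notMem]
  intro i hi
  rw [mem_R hU hst htn] at hi
  have := hr i
  simp only [mem_pathSet] at *
  grind

lemma pathValue_empty (hU : U ⊆ Ioo 1 n) : pathValue n U ∅ = 0 := by
  refine sum_eq_zero fun ⟨s, t⟩ h => ?_
  obtain ⟨h1, h2⟩ := pathSet_empty_gap hU h
  simp [segWeight, h1, h2, tri]

lemma pathValue_univ (hU : U ⊆ Ioo 1 n) : pathValue n U (Icc 1 n) = tri n := by
  have hU' : ∀ x ∈ U, 1 < x ∧ x < n := fun x hx => by simpa using hU hx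
  -- The path is `0`, the up labels, `n + 1`. Every segment has right set `[n]`, so its weight
  -- cancels unless it starts at `0`.
  have key : pathValue n U (Icc 1 n) = pathSum (fun s t => (0 : ℕ → ℝ) t +
      (if s = 0 then tri n else 0)) (pathSet n U (Icc 1 n)) := by
    refine sum_congr rfl fun ⟨s, t⟩ h => ?_
    rw [mem_consecPairs] at h
    obtain ⟨hs, ht, hst, hr⟩ := h
    have htn := le_of_mem_pathSet ht
    have hR : R n U s t = Icc 1 n := by
      ext i
      rw [mem_R hU hst htn]
      have := hr i
      simp only [mem_pathSet, mem_Icc] at *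
      grind
    have hc := card_R hU hst htn
    rw [hR, Nat.card_Icc, Nat.add_sub_cancel] at hc
    have hs' : s ∈ U ↔ s ≠ 0 := by
      simp only [mem_pathSet, mem_Icc] at *
      grind
    simp only [segWeight, ← hc, hs', Pi.zero_apply]
    split_ifs <;> simp_all
  rw [key, pathSet, pathSum_separable 0 (fun s => if s = 0 then tri n else 0) _
    (fun i hi => by simp only [mem_filter, mem_Icc, mem_Ioo] at *; omega) (Nat.succ_pos n),
    sum_eq_zero]
  · simp
  · intro i hi
    have : i ≠ 0 := by simp only [mem_filter, mem_Icc] at hi; omega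
    simp [this]

/-- On the path of `R a b`, every segment other than `(a, b)` is degenerate: it gives `∅` if both
its ends are down labels, and `[n]` otherwise. -/
lemma R_eq_of_mem_consecPairs (hU : U ⊆ Ioo 1 n) {a b s t : ℕ} (hab : a < b) (hb : b ≤ n + 1)
    (h : (s, t) ∈ consecPairs (pathSet n U (R n U a b))) (hne : (s, t) ≠ (a, b)) :
    R n U s t = ∅ ∨ R n U s t = Icc 1 n := by
  have hU' : ∀ x ∈ U, 1 < x ∧ x < n := fun x hx => by simpa using hU hx
  rw [mem_consecPairs] at h
  obtain ⟨hs, ht, hst, hr⟩ := h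
  have htn := le_of_mem_pathSet ht
  rw [Ne, Prod.mk.injEq] at hne
  have ha' := hr a
  have hb' := hr b
  have hU0 : 0 ∉ U := fun h => by have := hU' _ h; omega
  have hUn : n + 1 ∉ U := fun h => by have := hU' _ h; omega
  by_cases c : s ∉ U ∧ t ∉ U
  · left
    rw [eq_empty_iff_forall_notMem]
    intro i
    have hi := hr i
    simp only [mem_pathSet, mem_R hU hab hb, mem_R hU hst htn] at *
    clear hr hU
    by_cases c1 : a ∈ U <;> by_cases c2 : b ∈ U <;> by_cases c3 : i ∈ U <;> grind
  · right
    ext i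
    have hi := hr i
    simp only [mem_pathSet, mem_R hU hab hb, mem_R hU hst htn, mem_Icc] at *
    have hs' := hU' s
    have ht' := hU' t
    clear hr hU hU'
    by_cases c1 : a ∈ U <;> by_cases c2 : b ∈ U <;> by_cases c3 : i ∈ U <;>
      by_cases c4 : s ∈ U <;> by_cases c5 : t ∈ U <;>
      simp only [c1, c2, c3, c4, c5, true_and, false_and, and_true, and_false, not_true,
        not_false_eq_true, or_false, false_or, forall_true_left, false_imp_iff, true_iff,
        false_iff] at * <;> omega

lemma pathValue_R (hU : U ⊆ Ioo 1 n) {a b : ℕ} (hab : a < b) (hb : b ≤ n + 1) :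
    pathValue n U (R n U a b) = tri (R n U a b).card := by
  -- The constant vector `(n + 1) / 2` meets the bounds for `∅` and `[n]` with equality. Comparing
  -- with it leaves only the excess of the segment `(a, b)`.
  have key := sum_eq_pathSum hU (fun _ => ((n : ℝ) + 1) / 2) (R_subset hU hab hb)
  have hpath : (a, b) ∈ consecPairs (pathSet n U (R n U a b)) := by
    have hU' : ∀ x ∈ U, 1 < x ∧ x < n := fun x hx => by simpa using hU hx
    simp only [mem_consecPairs, mem_pathSet, mem_R hU hab hb]
    grind
  have hdiff : ∀ s t, (s, t) ∈ consecPairs (pathSet n U (R n U a b)) → 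
      segWeight n U s t = upperPart n U (fun _ => ((n : ℝ) + 1) / 2) t +
        (lowerPart n U (fun _ => ((n : ℝ) + 1) / 2) s -
          if s ∈ U then ∑ j ∈ Icc 1 n, (((n : ℝ) + 1) / 2) else 0) +
        (tri (R n U s t).card - ∑ j ∈ R n U s t, (((n : ℝ) + 1) / 2)) := by
    intro s t h
    rw [mem_consecPairs] at h
    have ht := le_of_mem_pathSet h.2.1
    rw [sum_R hU _ h.2.2.1 ht, segWeight, card_R hU h.2.2.1 ht]
    simp only [tri, sum_const, Nat.card_Icc, Nat.add_sub_cancel, nsmul_eq_mul]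
    split_ifs <;> ring
  rw [pathValue, pathSum, sum_congr rfl fun p hp => hdiff p.1 p.2 hp, sum_add_distrib]
  rw [pathSum] at key
  rw [← key, sum_eq_single_of_mem _ hpath]
  · simp
  · rintro ⟨s, t⟩ h hne
    rcases R_eq_of_mem_consecPairs hU hab hb h hne with h' | h' <;> simp only [h']
    · simp [tri]
    · simp only [tri, sum_const, Nat.card_Icc, Nat.add_sub_cancel, nsmul_eq_mul]
      ring

/-! ### Tight values -/

/-- A point of `ℝⁿ` as a function of the labels `1, …, n`. -/
def labelCoord (x : Fin n → ℝ) (k : ℕ) : ℝ := if h : k - 1 < n then x ⟨k - 1, h⟩ else 0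

lemma coordSum_eq_sum {I : Finset ℕ} (hI : I ⊆ Icc 1 n) (x : Fin n → ℝ) :
    coordSum n I x = ∑ i ∈ I, labelCoord x i := by
  have h : coordSum n I x = ∑ k ∈ range n, if k + 1 ∈ I then labelCoord x (k + 1) else 0 := by
    rw [← Fin.sum_univ_eq_sum_range (fun k => if k + 1 ∈ I then labelCoord x (k + 1) else 0)]
    refine sum_congr rfl fun i _ => ?_
    simp [labelCoord]
  have hIcc : Icc 1 n = (range n).image (· + 1) := by
    ext k
    simp only [mem_Icc, mem_image, mem_range]
    exact ⟨fun h => ⟨k - 1, by omega, by omega⟩, by rintro ⟨a, h, rfl⟩; omega⟩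
  rw [h, ← inter_eq_right.2 hI, ← sum_ite_mem, hIcc,
    sum_image (by simp), ← hIcc, inter_eq_right.2 hI]

lemma isLeast_coordSum_associahedron (hU : U ⊆ Ioo 1 n) {I : Finset ℕ} (hI : I ⊆ Icc 1 n) :
    IsLeast (coordSum n I '' associahedron n U) (pathValue n U I) := by
  constructor
  · obtain ⟨X, h1, h2, h3⟩ := exists_base_of_supermodular (pathValue_empty hU)
      pathValue_supermodular hI
    have hX : ∀ J ⊆ Icc 1 n, coordSum n J (fun i => X (i + 1)) = ∑ i ∈ J, X i := by
      intro J hJ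
      rw [coordSum_eq_sum hJ]
      refine sum_congr rfl fun i hi => ?_
      have := mem_Icc.1 (hJ hi)
      rw [labelCoord, dif_pos (by omega)]
      congr
      simp only
      omega
    refine ⟨fun i => X (i + 1), ⟨?_, fun a b hab => ?_⟩, by rw [hX I hI, h2]⟩
    · rw [hX _ Subset.rfl, h3, pathValue_univ hU, tri]
    · have hR := R_subset hU hab.1 hab.2.1
      rw [hX _ hR]
      exact (pathValue_R hU hab.1 hab.2.1).ge.trans (h1 _ hR)
  · rintro _ ⟨x, ⟨hx1, hx2⟩, rfl⟩
    rw [coordSum_eq_sum hI]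
    refine pathValue_le_sum hU hI ?_ fun s t hst => ?_
    · rw [← coordSum_eq_sum Subset.rfl, hx1, tri]
    · rw [← coordSum_eq_sum (R_subset hU hst.1 hst.2.1)]
      exact hx2 s t hst

lemma tightValue_eq (hU : U ⊆ Ioo 1 n) {I : Finset ℕ} (hI : I ⊆ Icc 1 n) :
    tightValue n U I = pathValue n U I :=
  (isLeast_coordSum_associahedron hU hI).csInf_eq

/-! ### Möbius inversion -/

/-- The Möbius inverse of a set function. -/
def moebiusInv (f : Finset ℕ → ℝ) (I : Finset ℕ) : ℝ :=
  ∑ J ∈ I.powerset, (-1 : ℝ) ^ (I \ J).card * f J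

lemma moebiusInv_congr {f g : Finset ℕ → ℝ} {I : Finset ℕ} (h : ∀ J ⊆ I, f J = g J) :
    moebiusInv f I = moebiusInv g I :=
  sum_congr rfl fun J hJ => by rw [h J (mem_powerset.1 hJ)]

lemma moebiusInv_sub (f g : Finset ℕ → ℝ) (I : Finset ℕ) :
    moebiusInv (fun J => f J - g J) I = moebiusInv f I - moebiusInv g I := by
  simp only [moebiusInv, mul_sub, sum_sub_distrib]

lemma moebiusInv_empty (f : Finset ℕ → ℝ) : moebiusInv f ∅ = f ∅ := by simp [moebiusInv]

/-- Möbius inversion is an iterated discrete derivative, one direction for each element of the set.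
-/
lemma moebiusInv_insert (f : Finset ℕ → ℝ) {I : Finset ℕ} {a : ℕ} (ha : a ∉ I) :
    moebiusInv f (insert a I) = moebiusInv (fun J => f (insert a J) - f J) I := by
  rw [moebiusInv_sub, moebiusInv, sum_powerset_insert ha, add_comm, sub_eq_add_neg, moebiusInv,
    moebiusInv, ← sum_neg_distrib]
  congr 1
  · refine sum_congr rfl fun J hJ => ?_
    rw [insert_sdiff_insert, sdiff_insert_of_notMem ha]
  · refine sum_congr rfl fun J hJ => ?_
    have : a ∉ J := fun h => ha (mem_powerset.1 hJ h)
    rw [insert_sdiff_of_notMem _ this, card_insert_of_notMem (by simp [ha]), pow_succ]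
    ring

lemma moebiusInv_eq {f g : Finset ℕ → ℝ} {I : Finset ℕ}
    (h : ∀ J ⊆ I, f J = ∑ K ∈ J.powerset, g K) : moebiusInv f I = g I := by
  induction I using Finset.induction_on generalizing f g with
  | empty => simpa [moebiusInv_empty] using h ∅ Subset.rfl
  | insert a I ha ih =>
    rw [moebiusInv_insert f ha, ih (g := fun K => g (insert a K))]
    intro J hJ
    have haJ : a ∉ J := fun h => ha (hJ h)
    rw [h _ (insert_subset_insert a hJ), h J (hJ.trans (subset_insert a I)),
      sum_powerset_insert haJ]
    ring

lemma minkowskiCoeff_eq (hU : U ⊆ Ioo 1 n) {I : Finset ℕ} (hI : I ⊆ Icc 1 n) :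
    minkowskiCoeff n U I = moebiusInv (pathValue n U) I :=
  moebiusInv_congr fun _ hJ => tightValue_eq hU (hJ.trans hI)

/-! ### Minkowski decompositions -/

lemma isLinearMap_coordSum (J : Finset ℕ) : IsLinearMap ℝ (coordSum n J) where
  map_add x y := by
    simp only [coordSum, ← sum_add_distrib, Pi.add_apply]
    exact sum_congr rfl fun i _ => by split_ifs <;> simp
  map_smul c x := by
    simp only [coordSum, smul_eq_mul, mul_sum, Pi.smul_apply, mul_ite, mul_zero]

lemma isLeast_image_add {f : (Fin n → ℝ) → ℝ} (hf : IsLinearMap ℝ f) {A B : Set (Fin n → ℝ)}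
    {a b : ℝ} (hA : IsLeast (f '' A) a) (hB : IsLeast (f '' B) b) :
    IsLeast (f '' (A + B)) (a + b) := by
  obtain ⟨⟨x, hx, rfl⟩, hA⟩ := hA
  obtain ⟨⟨y, hy, rfl⟩, hB⟩ := hB
  refine ⟨⟨x + y, Set.add_mem_add hx hy, hf.map_add x y⟩, ?_⟩
  rintro _ ⟨_, ⟨u, hu, v, hv, rfl⟩, rfl⟩
  rw [hf.map_add]
  exact add_le_add (hA ⟨u, hu, rfl⟩) (hB ⟨v, hv, rfl⟩)

lemma isLeast_image_smul {f : (Fin n → ℝ) → ℝ} (hf : IsLinearMap ℝ f) {A : Set (Fin n → ℝ)}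
    {a c : ℝ} (hc : 0 ≤ c) (hA : IsLeast (f '' A) a) : IsLeast (f '' (c • A)) (c * a) := by
  obtain ⟨⟨x, hx, rfl⟩, hA⟩ := hA
  refine ⟨⟨c • x, Set.smul_mem_smul_set hx, hf.map_smul c x⟩, ?_⟩
  rintro _ ⟨_, ⟨u, hu, rfl⟩, rfl⟩
  rw [hf.map_smul]
  exact mul_le_mul_of_nonneg_left (hA ⟨u, hu, rfl⟩) hc

lemma isLeast_image_sum {ι : Type*} {f : (Fin n → ℝ) → ℝ} (hf : IsLinearMap ℝ f) {s : Finset ι}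
    {A : ι → Set (Fin n → ℝ)} {a : ι → ℝ} (hA : ∀ i ∈ s, IsLeast (f '' A i) (a i)) :
    IsLeast (f '' ∑ i ∈ s, A i) (∑ i ∈ s, a i) := by
  classical
  induction s using Finset.induction_on with
  | empty =>
    rw [sum_empty, sum_empty, ← Set.singleton_zero, Set.image_singleton, hf.map_zero]
    exact isLeast_singleton
  | insert i s hi ih =>
    rw [sum_insert hi, sum_insert hi]
    exact isLeast_image_add hf (hA i (mem_insert_self i s))
      (ih fun j hj => hA j (mem_insert_of_mem hj))

lemma coordSum_single (J : Finset ℕ) (i : Fin n) :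
    coordSum n J (Pi.single i 1) = if (i : ℕ) + 1 ∈ J then 1 else 0 := by
  rw [coordSum, sum_eq_single i]
  · simp
  · intro j _ hj
    simp [hj]
  · simp

lemma isLeast_coordSum_simplexFace {I : Finset ℕ} (hI : I ⊆ Icc 1 n) (hne : I.Nonempty)
    (J : Finset ℕ) :
    IsLeast (coordSum n J '' simplexFace n I) (if I ⊆ J then 1 else 0) := by
  have hval : ∀ k ∈ I, ∃ x ∈ simplexFace n I, coordSum n J x = if k ∈ J then 1 else 0 := by
    intro k hk
    have hk' := mem_Icc.1 (hI hk)
    refine ⟨Pi.single ⟨k - 1, by omega⟩ 1, subset_convexHull ℝ _ ⟨⟨k - 1, by omega⟩, ?_, rfl⟩, ?_⟩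
    · simpa [Nat.sub_add_cancel hk'.1] using hk
    · simp [coordSum_single, Nat.sub_add_cancel hk'.1]
  constructor
  · by_cases h : I ⊆ J
    · obtain ⟨k, hk⟩ := hne
      obtain ⟨x, hx, hx'⟩ := hval k hk
      exact ⟨x, hx, by rw [hx', if_pos (h hk), if_pos h]⟩
    · obtain ⟨k, hk, hkJ⟩ := not_subset.1 h
      obtain ⟨x, hx, hx'⟩ := hval k hk
      exact ⟨x, hx, by rw [hx', if_neg hkJ, if_neg h]⟩
  · rintro _ ⟨x, hx, rfl⟩
    refine convexHull_min ?_ (convex_halfSpace_ge (isLinearMap_coordSum J) _) hx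
    rintro _ ⟨i, hi, rfl⟩
    rw [Set.mem_ofPred_eq, coordSum_single]
    by_cases h : I ⊆ J
    · rw [if_pos h, if_pos (h hi)]
    · rw [if_neg h]
      split_ifs <;> norm_num

/-- Minimising `coordSum n J` on both sides of the decomposition turns it into `z_J = ∑_{K ⊆ J}
y_K`, since `Δ_K` has minimum `1` if `K ⊆ J` and `0` otherwise. This system determines `y`. -/
lemma coeff_eq_moebiusInv (hU : U ⊆ Ioo 1 n) {y : Finset ℕ → ℝ}
    (hy : IsMinkowskiDecomposition n (associahedron n U) y) {I : Finset ℕ} (hI : I ⊆ Icc 1 n)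
    (hne : I.Nonempty) : y I = moebiusInv (pathValue n U) I := by
  -- The decomposition does not involve `y ∅`, so that value is replaced by `0`.
  have key : ∀ J ⊆ Icc 1 n,
      pathValue n U J = ∑ K ∈ J.powerset, if K = ∅ then 0 else y K := by
    intro J hJ
    have hf := isLinearMap_coordSum (n := n) J
    have hside : ∀ c : Finset ℕ → ℝ, (∀ K, 0 ≤ c K) →
        IsLeast (coordSum n J '' ∑ K ∈ (Icc 1 n).powerset.erase ∅, c K • simplexFace n K)
          (∑ K ∈ (Icc 1 n).powerset.erase ∅, c K * if K ⊆ J then 1 else 0) :=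
      fun c hc => isLeast_image_sum hf fun K hK => by
        rw [mem_erase, mem_powerset] at hK
        exact isLeast_image_smul hf (hc K)
          (isLeast_coordSum_simplexFace hK.2 (nonempty_iff_ne_empty.2 hK.1) J)
    have h1 := isLeast_image_add hf (isLeast_coordSum_associahedron hU hJ)
      (hside (fun K => max (-(y K)) 0) fun K => le_max_right _ _)
    have h2 := hside (fun K => max (y K) 0) fun K => le_max_right _ _
    rw [hy] at h1
    have h3 := h1.unique h2
    have h4 : pathValue n U J =
        ∑ K ∈ (Icc 1 n).powerset.erase ∅, if K ⊆ J then y K else 0 := by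
      rw [← eq_sub_iff_add_eq, ← sum_sub_distrib] at h3
      rw [h3]
      refine sum_congr rfl fun K _ => ?_
      split_ifs
      · rcases le_total 0 (y K) with h | h
        · rw [max_eq_left h, max_eq_right (by linarith)]; ring
        · rw [max_eq_right h, max_eq_left (by linarith)]; ring
      · ring
    have h5 : ((Icc 1 n).powerset.erase ∅).filter (· ⊆ J) = J.powerset.filter (¬ · = ∅) := by
      ext K
      simp only [mem_filter, mem_erase, mem_powerset, ne_eq]
      exact ⟨fun h => ⟨h.2, h.1.1⟩, fun h => ⟨⟨h.2, h.1.trans hJ⟩, h.1⟩⟩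
    rw [h4, ← sum_filter, h5, sum_filter]
    exact sum_congr rfl fun K _ => ite_not _ _ _
  rw [moebiusInv_eq (g := fun K => if K = ∅ then 0 else y K) fun J hJ => key J (hJ.trans hI),
    if_neg hne.ne_empty]

/-! ### Vanishing of the coefficients -/

lemma moebiusInv_pathValue_of_lt (hU : U ⊆ Ioo 1 n) {I : Finset ℕ} (hI : I ⊆ Icc 1 n) {m M : ℕ}
    (hm : m ∈ I) (hM : M ∈ I) (hmM : m < M) (hI' : ∀ i ∈ I, m ≤ i ∧ i ≤ M) :
    moebiusInv (pathValue n U) I = 0 ↔ ∃ d, m < d ∧ d < M ∧ d ∉ U ∧ d ∉ I := by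
  have hmn := mem_Icc.1 (hI hm)
  have hMn := mem_Icc.1 (hI hM)
  set I' := I \ {m, M} with hI'def
  have hmI' : m ∉ I' := by simp [hI'def]
  have hMI' : M ∉ I' := by simp [hI'def]
  have hII' : I = insert m (insert M I') := by
    ext i
    simp only [hI'def, mem_insert, mem_sdiff, mem_singleton]
    grind
  have hexp : moebiusInv (pathValue n U) I = ∑ K ∈ I'.powerset, (-1 : ℝ) ^ (I' \ K).card *
      (pathValue n U (insert M (insert m K)) - pathValue n U (insert m K)
        - pathValue n U (insert M K) + pathValue n U K) := by
    conv_lhs => rw [hII']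
    rw [moebiusInv_insert _ (by simp [hmI', hmM.ne]), moebiusInv_insert _ hMI', moebiusInv]
    refine sum_congr rfl fun K _ => ?_
    rw [insert_comm]
    ring
  have hK : ∀ K ⊆ I', m ∉ K ∧ M ∉ K ∧ ∀ k ∈ K, m < k ∧ k < M ∧ k ∈ I := by
    intro K hK
    refine ⟨fun h => hmI' (hK h), fun h => hMI' (hK h), fun k hk => ?_⟩
    have h1 := hK hk
    simp only [hI'def, mem_sdiff, mem_insert, mem_singleton] at h1
    have := hI' k h1.1
    exact ⟨by omega, by omega, h1.1⟩
  by_cases hd : ∃ d, m < d ∧ d < M ∧ d ∉ U ∧ d ∉ I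
  · refine iff_of_true ?_ hd
    obtain ⟨d, h1, h2, h3, h4⟩ := hd
    rw [hexp]
    refine sum_eq_zero fun K hK' => ?_
    obtain ⟨k1, k2, k3⟩ := hK K (mem_powerset.1 hK')
    rw [pathValue_secondDiff_eq_zero (hI hm) (hI hM) k1 k2 h1 h2, mul_zero]
    rw [mem_pathSet]
    exact Or.inr (Or.inr ⟨by omega, iff_of_false h3 fun h => h4 (k3 d h).2.2⟩)
  · refine iff_of_false ?_ hd
    push Not at hd
    -- The path of `K` avoids the open gap `(m, M)` only if `K` contains every down label and no up
    -- label there.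
    set K₀ := I'.filter (· ∉ U) with hK₀
    obtain ⟨k1, k2, k3⟩ := hK K₀ (filter_subset _ _)
    have hmem : ∀ r, m < r → r < M → (r ∈ K₀ ↔ r ∉ U) := by
      intro r h1 h2
      simp only [hK₀, hI'def, mem_filter, mem_sdiff, mem_insert, mem_singleton]
      have := hd r h1 h2
      exact ⟨fun h => h.2, fun h => ⟨⟨this h, by omega⟩, h⟩⟩
    rw [hexp, sum_eq_single_of_mem K₀ (mem_powerset.2 (filter_subset _ _))]
    · obtain ⟨p, q, h, hpm, hmq⟩ := exists_consecPair (S := pathSet n U K₀ \ {m, M}) (i := m)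
        (by simp)
        ⟨0, by simp only [mem_sdiff, zero_mem_pathSet, mem_insert, mem_singleton, true_and]; omega,
          by omega⟩
        ⟨n + 1, by
          simp only [mem_sdiff, succ_mem_pathSet, mem_insert, mem_singleton, true_and]; omega,
          by omega⟩
      have hnotU : ∀ r ∈ pathSet n U K₀, r ∉ U := by
        intro r hr hrU
        have := mem_Ioo.1 (hU hrU)
        rw [mem_pathSet] at hr
        have hr' : r ∈ K₀ := by
          rcases hr with hr | hr | hr
          · omega
          · omega
          · exact hr.2.1 hrU
        exact (mem_filter.1 hr').2 hrU
      have h' := mem_consecPairs.1 h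
      simp only [mem_sdiff, mem_insert, mem_singleton] at h'
      have hMq : M < q := by
        by_contra hlt
        have hqM : q < M := by omega
        have h5 := mem_pathSet.1 h'.2.1.1
        have h6 := hmem q hmq hqM
        have h7 := hnotU q h'.2.1.1
        have : q ∈ U ↔ q ∈ K₀ := by
          rcases h5 with h5 | h5 | h5
          · omega
          · omega
          · exact h5.2
        tauto
      rw [pathValue_secondDiff_eq (hI hm) (hI hM) k1 k2 hmM h hpm hMq]
      exact mul_ne_zero (pow_ne_zero _ (by norm_num)) (mul_pos
        (toggleSign_mul_lowerPart_pos (hI hm) hpm (hnotU p h'.1.1))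
        (toggleSign_mul_upperPart_pos (hI hM) hMq (hnotU q h'.2.1.1))).ne'
    · intro K hKI' hne
      obtain ⟨l1, l2, l3⟩ := hK K (mem_powerset.1 hKI')
      obtain ⟨r, hr⟩ : ∃ r, ¬ (r ∈ K ↔ r ∈ K₀) := by
        by_contra! hcon
        exact hne (Finset.ext hcon)
      have hr' : m < r ∧ r < M := by
        by_cases hrK : r ∈ K
        · exact ⟨(l3 r hrK).1, (l3 r hrK).2.1⟩
        · have hrK₀ : r ∈ K₀ := by tauto
          exact ⟨(k3 r hrK₀).1, (k3 r hrK₀).2.1⟩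
      have h6 := hmem r hr'.1 hr'.2
      rw [pathValue_secondDiff_eq_zero (hI hm) (hI hM) l1 l2 hr'.1 hr'.2, mul_zero]
      rw [mem_pathSet]
      exact Or.inr (Or.inr ⟨by omega, by tauto⟩)

/-! ### Coefficients of singletons -/

lemma moebiusInv_singleton (f : Finset ℕ → ℝ) (m : ℕ) : moebiusInv f {m} = f {m} - f ∅ := by
  rw [← insert_empty_eq, moebiusInv_insert f (notMem_empty m), moebiusInv_empty]

lemma moebiusInv_pathValue_singleton_ne_zero (hU : U ⊆ Ioo 1 n) {m : ℕ} (hm : m ∈ Icc 1 n)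
    (hmU : m ∉ U) : moebiusInv (pathValue n U) {m} ≠ 0 := by
  have hm' := mem_Icc.1 hm
  have hset : pathSet n U ∅ = insert m (pathSet n U {m}) := by
    ext k
    simp only [mem_pathSet, mem_insert, mem_singleton, notMem_empty, iff_false]
    grind
  have hmS : m ∉ pathSet n U {m} := by
    simp only [mem_pathSet, mem_singleton]
    grind
  obtain ⟨p, q, h, hpm, hmq⟩ := exists_consecPair hmS ⟨0, zero_mem_pathSet _, by omega⟩
    ⟨n + 1, succ_mem_pathSet _, by omega⟩
  have hins := consecPairs_insert h hpm hmq
  rw [← hset] at hins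
  obtain ⟨hpU, e1⟩ := pathSet_empty_gap hU (s := p) (t := m) (by rw [hins]; simp)
  obtain ⟨-, e2⟩ := pathSet_empty_gap hU (s := m) (t := q) (by rw [hins]; simp)
  have e3 := upperPart_add_lowerPart_self (U := U) 1 hm
  have hs := pathSum_insert (segWeight n U) h hpm hmq
  rw [← hset] at hs
  simp only [hmU, if_false, sub_zero, Pi.one_apply] at e3
  have e4 : upperPart n U 1 q + lowerPart n U 1 p = 1 := by linarith
  simp only [segWeight, e1, e2, e4, hpU, hmU, if_false, tri] at hs
  rw [moebiusInv_singleton, pathValue, pathValue, hs]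
  norm_num

lemma moebiusInv_pathValue_singleton_eq_zero_iff (hU : U ⊆ Ioo 1 n) {m : ℕ} (hmU : m ∈ U) :
    moebiusInv (pathValue n U) {m} = 0 ↔ n = 3 ∧ {m} = U ∧ U = {2} := by
  have hU' : ∀ x ∈ U, 1 < x ∧ x < n := fun x hx => by simpa using hU hx
  have hm' := hU' m hmU
  have h1U : 1 ∉ U := fun h => by have := hU' _ h; omega
  have hnU : n ∉ U := fun h => by have := hU' _ h; omega
  have hm : m ∈ Icc 1 n := by rw [mem_Icc]; omega
  have hset : pathSet n U {m} = insert m (pathSet n U ∅) := by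
    ext k
    simp only [mem_pathSet, mem_insert, mem_singleton, notMem_empty, iff_false]
    grind
  have hmS : m ∉ pathSet n U ∅ := by
    simp only [mem_pathSet, notMem_empty]
    grind
  obtain ⟨p, q, h, hpm, hmq⟩ := exists_consecPair hmS ⟨0, zero_mem_pathSet _, by omega⟩
    ⟨n + 1, succ_mem_pathSet _, by omega⟩
  have hqn : q ≤ n + 1 := le_of_mem_pathSet (mem_consecPairs.1 h).2.1
  obtain ⟨hpU, e1⟩ := pathSet_empty_gap hU h
  have hqU : q ∉ U := by
    have := mem_pathSet.1 (mem_consecPairs.1 h).2.1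
    simp only [notMem_empty, iff_false] at this
    grind
  have e3 := upperPart_add_lowerPart_self (U := U) 1 hm
  have hs := pathSum_insert (segWeight n U) h hpm hmq
  rw [← hset] at hs
  simp only [hmU, if_true, Pi.one_apply, sum_const, Nat.card_Icc, Nat.add_sub_cancel,
    nsmul_eq_mul, mul_one] at e3
  have c1 := card_R hU hpm (by omega : m ≤ n + 1)
  have c2 := card_R hU hmq hqn
  -- `R p m` contains `m` and `n`, and `R m q` below contains `m` and `1`.
  have r1 : 2 ≤ (R n U p m).card := by
    rw [← card_pair (show m ≠ n by omega)]
    refine card_le_card fun i => ?_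
    simp only [mem_insert, mem_singleton]
    rintro (rfl | rfl) <;> rw [mem_R hU hpm (by omega)] <;> grind
  have r2 : 2 ≤ (R n U m q).card := by
    rw [← card_pair (show m ≠ 1 by omega)]
    refine card_le_card fun i => ?_
    simp only [mem_insert, mem_singleton]
    rintro (rfl | rfl) <;> rw [mem_R hU hmq hqn] <;> grind
  have hsum : (R n U p m).card + (R n U m q).card = n + 1 := by
    have : ((R n U p m).card : ℝ) + (R n U m q).card = n + 1 := by linarith
    exact_mod_cast this
  -- With `r + l = n + 1`, this is `tri r + tri l - tri n = 1 - (r - 1) (l - 1)`. As `r, l ≥ 2`, it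
  -- vanishes only for `r = l = 2`, that is, `n = 3`.
  have hval : moebiusInv (pathValue n U) {m} =
      1 - (((R n U p m).card : ℝ) - 1) * ((R n U m q).card - 1) := by
    have hn : (n : ℝ) = (R n U p m).card + (R n U m q).card - 1 := by
      rw [eq_sub_iff_add_eq]; exact_mod_cast hsum.symm
    simp only [segWeight, ← c1, ← c2, e1, hpU, hmU, if_true, if_false] at hs
    rw [moebiusInv_singleton, pathValue, pathValue, hs, hn]
    simp only [tri]
    ring
  rw [hval]
  generalize (R n U p m).card = r at *
  generalize (R n U m q).card = l at *
  obtain ⟨r, rfl⟩ := Nat.exists_eq_add_of_le r1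
  obtain ⟨l, rfl⟩ := Nat.exists_eq_add_of_le r2
  have hiff : (1 : ℝ) - (((2 + r : ℕ) : ℝ) - 1) * (((2 + l : ℕ) : ℝ) - 1) = 0 ↔
      r = 0 ∧ l = 0 := by
    push_cast
    constructor
    · intro h
      have h' : (r : ℝ) + l + r * l = 0 := by linarith
      have h'' : r + l + r * l = 0 := by exact_mod_cast h'
      omega
    · rintro ⟨rfl, rfl⟩
      norm_num
  rw [hiff]
  constructor
  · rintro ⟨rfl, rfl⟩
    have hU2 : U = {2} := by
      ext k
      rw [mem_singleton]
      exact ⟨fun hk => by have := hU' k hk; omega, fun hk => by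
        rwa [hk, show 2 = m by omega]⟩
    refine ⟨by omega, ?_, hU2⟩
    rw [hU2, show m = 2 by omega]
  · rintro ⟨rfl, -, -⟩
    omega

/-- The coefficient of `I` vanishes if and only if a down label outside of `I` separates two
elements of `I`, up to the exceptional case. -/
lemma moebiusInv_pathValue_eq_zero_iff (hU : U ⊆ Ioo 1 n) {I : Finset ℕ} (hI : I ⊆ Icc 1 n)
    (hne : I.Nonempty) : moebiusInv (pathValue n U) I = 0 ↔
      (∃ i ∈ I, ∃ j ∈ I, ∃ d, i < d ∧ d < j ∧ d ∉ U ∧ d ∉ I) ∨ (n = 3 ∧ I = U ∧ U = {2}) := by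
  have hm := I.min'_mem hne
  have hM := I.max'_mem hne
  rcases (I.min'_le_max' hne).lt_or_eq with h | h
  · rw [moebiusInv_pathValue_of_lt hU hI hm hM h fun i hi => ⟨I.min'_le i hi, I.le_max' i hi⟩]
    constructor
    · rintro ⟨d, h1, h2, h3⟩
      exact Or.inl ⟨_, hm, _, hM, d, h1, h2, h3⟩
    · rintro (⟨i, hi, j, hj, d, h1, h2, h3⟩ | ⟨-, h1, h2⟩)
      · exact ⟨d, (I.min'_le i hi).trans_lt h1, h2.trans_le (I.le_max' j hj), h3⟩
      · subst h1
        simp [h2] at h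
  · have hsing : I = {I.min' hne} := by
      refine eq_singleton_iff_unique_mem.2 ⟨hm, fun i hi => ?_⟩
      have h1 := I.min'_le i hi
      have h2 := I.le_max' i hi
      omega
    generalize I.min' hne = m at *
    subst hsing
    have hno : ¬ ∃ i ∈ ({m} : Finset ℕ), ∃ j ∈ ({m} : Finset ℕ), ∃ d, i < d ∧ d < j ∧ d ∉ U ∧
        d ∉ ({m} : Finset ℕ) := by
      rintro ⟨i, hi, j, hj, d, h1, h2, -⟩
      rw [mem_singleton] at hi hj
      omega
    rw [or_iff_right hno]
    by_cases hmU : m ∈ U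
    · exact moebiusInv_pathValue_singleton_eq_zero_iff hU hmU
    · refine iff_of_false (moebiusInv_pathValue_singleton_ne_zero hU (hI hm) hmU) ?_
      rintro ⟨-, h1, -⟩
      exact hmU (h1 ▸ mem_singleton_self m)

/-! ### The type of the up and down interval decomposition -/

lemma mem_downInt {a b d : ℕ} (hb : b ≤ n + 1) :
    d ∈ downInt n U (a, b) ↔ d ∉ U ∧ a < d ∧ d < b := by
  simp only [downInt, downSet, mem_filter, mem_sdiff, mem_Icc]
  constructor
  · tauto
  · intro h
    exact ⟨⟨by omega, h.1⟩, h.2⟩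

/-- Maximality means that both end-points avoid `I`: an end-point in `I` could be moved to the next
down label outwards, enlarging the interval within `I`. -/
lemma mem_maxDownInts (hU : U ⊆ Ioo 1 n) {I : Finset ℕ} (hI : I ⊆ Icc 1 n) {a b : ℕ} :
    (a, b) ∈ maxDownInts n U I ↔ (b ≤ n + 1 ∧ a ∉ U ∧ b ∉ U ∧ a ∉ I ∧ b ∉ I) ∧
      (∃ d ∉ U, a < d ∧ d < b) ∧ ∀ d ∉ U, a < d → d < b → d ∈ I := by
  have hU' : ∀ x ∈ U, 1 < x ∧ x < n := fun x hx => by simpa using hU hx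
  have hI' : ∀ x ∈ I, 1 ≤ x ∧ x ≤ n := fun x hx => by simpa using hI hx
  simp only [maxDownInts, mem_filter, mem_product, mem_downBar hU, Prod.forall]
  constructor
  · rintro ⟨⟨⟨ha, haU⟩, hb, hbU⟩, ⟨d, hd⟩, hsub, hmax⟩
    rw [mem_downInt hb] at hd
    have hsub' : ∀ d ∉ U, a < d → d < b → d ∈ I := fun d h1 h2 h3 =>
      hsub ((mem_downInt hb).2 ⟨h1, h2, h3⟩)
    refine ⟨⟨hb, haU, hbU, fun haI => ?_, fun hbI => ?_⟩, ⟨d, hd⟩, hsub'⟩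
    · have hne : ((range a).filter (· ∉ U)).Nonempty := by
        refine ⟨0, ?_⟩
        simp only [mem_filter, mem_range]
        exact ⟨by have := hI' a haI; omega, fun h => by have := hU' 0 h; omega⟩
      obtain ⟨a', ha', hmx⟩ := exists_max_image _ id hne
      simp only [mem_filter, mem_range, id] at ha' hmx
      have heq := hmax a' b ⟨⟨by omega, ha'.2⟩, hb, hbU⟩
        (fun e he => by
          rw [mem_downInt hb] at he
          rcases lt_trichotomy e a with h | rfl | h
          · have := hmx e ⟨h, he.1⟩; omega
          · exact haI
          · exact hsub' e he.1 h he.2.2)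
        (fun e he => by
          rw [mem_downInt hb] at he ⊢
          exact ⟨he.1, by omega, he.2.2⟩)
      have : a ∈ downInt n U (a, b) := by
        rw [← heq, mem_downInt hb]
        exact ⟨haU, ha'.1, by omega⟩
      rw [mem_downInt hb] at this
      omega
    · have hne : ((Ioc b (n + 1)).filter (· ∉ U)).Nonempty := by
        refine ⟨n + 1, ?_⟩
        simp only [mem_filter, mem_Ioc]
        exact ⟨by have := hI' b hbI; omega, fun h => by have := hU' _ h; omega⟩
      obtain ⟨b', hb', hmn⟩ := exists_min_image _ id hne
      simp only [mem_filter, mem_Ioc, id] at hb' hmn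
      have heq := hmax a b' ⟨⟨ha, haU⟩, hb'.1.2, hb'.2⟩
        (fun e he => by
          rw [mem_downInt hb'.1.2] at he
          rcases lt_trichotomy e b with h | rfl | h
          · exact hsub' e he.1 he.2.1 h
          · exact hbI
          · have := hmn e ⟨⟨h, by omega⟩, he.1⟩; omega)
        (fun e he => by
          rw [mem_downInt hb] at he
          rw [mem_downInt hb'.1.2]
          exact ⟨he.1, he.2.1, by omega⟩)
      have : b ∈ downInt n U (a, b) := by
        rw [← heq, mem_downInt hb'.1.2]
        exact ⟨hbU, by omega, hb'.1.1⟩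
      rw [mem_downInt hb] at this
      omega
  · rintro ⟨⟨hb, haU, hbU, haI, hbI⟩, ⟨d, hd⟩, hsub⟩
    refine ⟨⟨⟨by omega, haU⟩, hb, hbU⟩, ⟨d, (mem_downInt hb).2 hd⟩, fun e he => ?_,
      fun a' b' ⟨_, hb', _⟩ hsub' hle => hle.antisymm' fun e he => ?_⟩
    · rw [mem_downInt hb] at he
      exact hsub e he.1 he.2.1 he.2.2
    · have h1 := hle ((mem_downInt hb).2 hd)
      rw [mem_downInt hb'] at h1 he
      rw [mem_downInt hb]
      refine ⟨he.1, lt_of_not_ge fun h => ?_, lt_of_not_ge fun h => ?_⟩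
      · exact haI (hsub' ((mem_downInt hb').2 ⟨haU, by omega, by omega⟩))
      · exact hbI (hsub' ((mem_downInt hb').2 ⟨hbU, by omega, by omega⟩))

lemma exists_gap (hU : U ⊆ Ioo 1 n) {I : Finset ℕ} (hI : I ⊆ Icc 1 n) {i : ℕ} (hi : i ∈ I) :
    ∃ a b, (b ≤ n + 1 ∧ a ∉ U ∧ b ∉ U ∧ a ∉ I ∧ b ∉ I) ∧ (a < i ∧ i < b) ∧
      ∀ d ∉ U, a < d → d < b → d ∈ I := by
  have hU' : ∀ x ∈ U, 1 < x ∧ x < n := fun x hx => by simpa using hU hx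
  have hI' : ∀ x ∈ I, 1 ≤ x ∧ x ≤ n := fun x hx => by simpa using hI hx
  have hin := hI' i hi
  have h1 : ((range i).filter (fun a => a ∉ U ∧ a ∉ I)).Nonempty := by
    refine ⟨0, ?_⟩
    simp only [mem_filter, mem_range]
    exact ⟨by omega, fun h => by have := hU' 0 h; omega, fun h => by have := hI' 0 h; omega⟩
  have h2 : ((Ioc i (n + 1)).filter (fun a => a ∉ U ∧ a ∉ I)).Nonempty := by
    refine ⟨n + 1, ?_⟩
    simp only [mem_filter, mem_Ioc]
    exact ⟨by omega, fun h => by have := hU' _ h; omega, fun h => by have := hI' _ h; omega⟩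
  obtain ⟨a, ha, hmx⟩ := exists_max_image _ id h1
  obtain ⟨b, hb, hmn⟩ := exists_min_image _ id h2
  simp only [mem_filter, mem_range, mem_Ioc, id] at ha hb hmx hmn
  refine ⟨a, b, ⟨hb.1.2, ha.2.1, hb.2.1, ha.2.2, hb.2.2⟩, ⟨ha.1, hb.1.1⟩, fun d hd h3 h4 => ?_⟩
  by_contra hdI
  rcases lt_trichotomy d i with h | rfl | h
  · have := hmx d ⟨h, hd, hdI⟩; omega
  · exact hdI hi
  · have := hmn d ⟨⟨h, by omega⟩, hd, hdI⟩; omega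

/-- The gap condition says that neither end-point is in `I`, because a down label of `I` lies
strictly inside some maximal down interval. -/
lemma mem_emptyDownInts (hU : U ⊆ Ioo 1 n) {I : Finset ℕ} (hI : I ⊆ Icc 1 n) {a b : ℕ} :
    (a, b) ∈ emptyDownInts n U I ↔ (1 ≤ a ∧ a < b ∧ b ≤ n ∧ a ∉ U ∧ b ∉ U ∧ a ∉ I ∧ b ∉ I) ∧
      ∀ d ∉ U, ¬ (a < d ∧ d < b) := by
  simp only [emptyDownInts, mem_filter, mem_product, downSet, mem_sdiff, mem_Icc, Prod.forall,
    eq_empty_iff_forall_notMem]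
  constructor
  · rintro ⟨⟨⟨ha, haU⟩, hb, hbU⟩, hab, hemp, hgap⟩
    have hemp' : ∀ d ∉ U, ¬ (a < d ∧ d < b) := fun d hd h =>
      hemp d ((mem_downInt (by omega)).2 ⟨hd, h⟩)
    have hout : ∀ c, c ∉ U → (c = a ∨ c = b) → c ∉ I := by
      intro c hcU hc hcI
      obtain ⟨a', b', h1, h2, h3⟩ := exists_gap hU hI hcI
      have := hgap a' b' ((mem_maxDownInts hU hI).2 ⟨h1, ⟨c, hcU, h2⟩, h3⟩)
      omega
    exact ⟨⟨ha.1, hab, hb.2, haU, hbU, hout a haU (Or.inl rfl), hout b hbU (Or.inr rfl)⟩, hemp'⟩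
  · rintro ⟨⟨ha, hab, hb, haU, hbU, haI, hbI⟩, hemp⟩
    refine ⟨⟨⟨by omega, haU⟩, by omega, hbU⟩, hab,
      fun d hd => hemp d ((mem_downInt (by omega)).1 hd).1
        ((mem_downInt (by omega)).1 hd).2, fun a' b' h => ?_⟩
    obtain ⟨⟨hb', ha'U, hb'U, ha'I, hb'I⟩, ⟨d, hdU, had, hdb⟩, hsub⟩ := (mem_maxDownInts hU hI).1 h
    by_contra! hcon
    have h1 := hemp a' ha'U
    have h2 := hemp b' hb'U
    have h3 := hemp d hdU
    have h4 := hsub a haU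
    have h5 := hsub b hbU
    by_cases h6 : a' < a
    · exact haI (h4 h6 (by omega))
    by_cases h7 : b < b'
    · exact hbI (h5 (by omega) h7)
    omega

lemma mem_upInt {α β u : ℕ} : u ∈ upInt U (α, β) ↔ u ∈ U ∧ α ≤ u ∧ u ≤ β := by
  simp [upInt]

lemma exists_upParts {I : Finset ℕ} {E : ℕ × ℕ}
    (hE : E ∈ maxDownInts n U I ∪ emptyDownInts n U I) {u : ℕ} (hu : u ∈ U) (huI : u ∈ I)
    (huE : u ∈ Ioo E.1 E.2) : ∃ p ∈ upParts n U I, upInt U p ⊆ Ioo E.1 E.2 := by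
  set C := (U ×ˢ U).filter (fun p => u ∈ upInt U p ∧ upInt U p ⊆ I ∩ Ioo E.1 E.2) with hC
  have hne : C.Nonempty := by
    refine ⟨(u, u), ?_⟩
    rw [hC, mem_filter, mem_product]
    refine ⟨⟨hu, hu⟩, mem_upInt.2 ⟨hu, le_rfl, le_rfl⟩, fun v hv => ?_⟩
    rw [mem_upInt] at hv
    rw [show v = u by omega]
    exact mem_inter.2 ⟨huI, huE⟩
  obtain ⟨p, hp, hmax⟩ := exists_max_image C (fun p => (upInt U p).card) hne
  rw [hC, mem_filter] at hp
  refine ⟨p, ?_, hp.2.2.trans inter_subset_right⟩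
  rw [upParts, mem_filter]
  refine ⟨hp.1, ?_, E, hE, hp.2.2, fun q hq hqs hpq => ?_⟩
  · have := mem_upInt.1 hp.2.1
    omega
  · have hqC : q ∈ C := by
      rw [hC, mem_filter]
      exact ⟨hq, hpq hp.2.1, hqs⟩
    exact (eq_of_subset_of_card_le hpq (hmax q hqC)).symm

/-- This treats empty and non-empty down intervals uniformly. An empty one is retained exactly when
an up label of `I` lies in its gap, since a maximal up interval then exists there. -/
lemma mem_downParts (hU : U ⊆ Ioo 1 n) {I : Finset ℕ} (hI : I ⊆ Icc 1 n) {a b : ℕ} :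
    (a, b) ∈ downParts n U I ↔ (b ≤ n + 1 ∧ a ∉ U ∧ b ∉ U ∧ a ∉ I ∧ b ∉ I) ∧
      (∃ i ∈ I, a < i ∧ i < b) ∧ ∀ d ∉ U, a < d → d < b → d ∈ I := by
  have hU' : ∀ x ∈ U, 1 < x ∧ x < n := fun x hx => by simpa using hU hx
  have hI' : ∀ x ∈ I, 1 ≤ x ∧ x ≤ n := fun x hx => by simpa using hI hx
  rw [downParts, mem_union, mem_filter]
  constructor
  · rintro (h | ⟨h, p, hp, hpE⟩)
    · obtain ⟨h1, ⟨d, h2, h3⟩, h4⟩ := (mem_maxDownInts hU hI).1 h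
      exact ⟨h1, ⟨d, h4 d h2 h3.1 h3.2, h3⟩, h4⟩
    · obtain ⟨h1, h2⟩ := (mem_emptyDownInts hU hI).1 h
      refine ⟨⟨by omega, h1.2.2.2⟩, ?_, fun d hd h3 h4 => (h2 d hd ⟨h3, h4⟩).elim⟩
      rw [upParts, mem_filter, mem_product] at hp
      obtain ⟨⟨hp1, -⟩, hle, E, -, hsub, -⟩ := hp
      have hmem : p.1 ∈ upInt U p := mem_upInt.2 ⟨hp1, le_rfl, hle⟩
      exact ⟨p.1, (mem_inter.1 (hsub hmem)).1, mem_Ioo.1 (hpE hmem)⟩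
  · rintro ⟨h1, ⟨i, hi, hab⟩, h3⟩
    by_cases hne : ∃ d ∉ U, a < d ∧ d < b
    · exact Or.inl ((mem_maxDownInts hU hI).2 ⟨h1, hne, h3⟩)
    · right
      have hne' : ∀ d ∉ U, ¬ (a < d ∧ d < b) := fun d hd h => hne ⟨d, hd, h⟩
      have hin := hI' i hi
      have hiU : i ∈ U := by
        by_contra hiU
        exact hne' i hiU hab
      have hi2 := hU' i hiU
      -- As `1` and `n` are down labels, a gap containing an up label but no down label cannot start
      -- at `0` or end at `n + 1`.
      have ha : 1 ≤ a := by
        have := hne' 1 fun h => by have := hU' 1 h; omega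
        omega
      have hb : b ≤ n := by
        have := hne' n fun h => by have := hU' n h; omega
        omega
      have hE : (a, b) ∈ emptyDownInts n U I :=
        (mem_emptyDownInts hU hI).2 ⟨⟨ha, by omega, hb, h1.2⟩, hne'⟩
      exact ⟨hE, exists_upParts (mem_union_right _ hE) hiU hi (mem_Ioo.2 hab)⟩

/-- Two distinct gaps cannot overlap, as an end-point of one inside the other would belong to `I`.
Hence an end-point of one of them separates their elements of `I`. -/
lemma one_lt_card_downParts_iff (hU : U ⊆ Ioo 1 n) {I : Finset ℕ} (hI : I ⊆ Icc 1 n) :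
    1 < (downParts n U I).card ↔ ∃ i ∈ I, ∃ j ∈ I, ∃ d, i < d ∧ d < j ∧ d ∉ U ∧ d ∉ I := by
  rw [one_lt_card]
  constructor
  · rintro ⟨⟨a, b⟩, h1, ⟨a', b'⟩, h2, hne⟩
    obtain ⟨⟨hb, haU, hbU, haI, hbI⟩, ⟨i, hi, hai, hib⟩, h3⟩ := (mem_downParts hU hI).1 h1
    obtain ⟨⟨hb', haU', hbU', haI', hbI'⟩, ⟨j, hj, haj, hjb⟩, h4⟩ := (mem_downParts hU hI).1 h2
    by_cases c1 : b ≤ a'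
    · exact ⟨i, hi, j, hj, b, hib, by omega, hbU, hbI⟩
    by_cases c2 : b' ≤ a
    · exact ⟨j, hj, i, hi, b', hjb, by omega, hbU', hbI'⟩
    exfalso
    apply hne
    have ea : a = a' := by
      rcases lt_trichotomy a a' with h | h | h
      · exact (haI' (h3 a' haU' h (by omega))).elim
      · exact h
      · exact (haI (h4 a haU h (by omega))).elim
    have eb : b = b' := by
      rcases lt_trichotomy b b' with h | h | h
      · exact (hbI (h4 b hbU (by omega) h)).elim
      · exact h
      · exact (hbI' (h3 b' hbU' (by omega) h)).elim
    rw [ea, eb]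
  · rintro ⟨i, hi, j, hj, d, hid, hdj, hdU, hdI⟩
    obtain ⟨a, b, h1, h2, h3⟩ := exists_gap hU hI hi
    obtain ⟨a', b', h1', h2', h3'⟩ := exists_gap hU hI hj
    refine ⟨(a, b), (mem_downParts hU hI).2 ⟨h1, ⟨i, hi, h2⟩, h3⟩, (a', b'),
      (mem_downParts hU hI).2 ⟨h1', ⟨j, hj, h2'⟩, h3'⟩, fun h => ?_⟩
    rw [Prod.mk.injEq] at h
    exact hdI (h3 d hdU (by omega) (by omega))

end Assoc

theorem mainTheorem5 (n : ℕ) (hn : 2 ≤ n) (U : Finset ℕ) (hU : U ⊆ Finset.Ioo 1 n)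
    (I : Finset ℕ) (hI : I ⊆ Finset.Icc 1 n) (hne : I.Nonempty) :
    (Assoc.minkowskiCoeff n U I = 0 ↔
      (∃ v w : ℕ, Assoc.HasUpDownType n U I v w ∧ 1 < v) ∨ (n = 3 ∧ I = U ∧ U = {2})) ∧
    (∀ y : Finset ℕ → ℝ,
      Assoc.IsMinkowskiDecomposition n (Assoc.associahedron n U) y →
      (y I = 0 ↔
        (∃ v w : ℕ, Assoc.HasUpDownType n U I v w ∧ 1 < v) ∨ (n = 3 ∧ I = U ∧ U = {2}))) := by
  have hz := Assoc.moebiusInv_pathValue_eq_zero_iff hU hI hne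
  have ht : (∃ v w : ℕ, Assoc.HasUpDownType n U I v w ∧ 1 < v) ↔
      1 < (Assoc.downParts n U I).card :=
    ⟨fun ⟨_, _, h, hv⟩ => h.1 ▸ hv, fun h => ⟨_, _, ⟨rfl, rfl⟩, h⟩⟩
  rw [ht, Assoc.one_lt_card_downParts_iff hU hI, Assoc.minkowskiCoeff_eq hU hI]
  exact ⟨hz, fun y hy => by rw [Assoc.coeff_eq_moebiusInv hU hy hI hne]; exact hz⟩
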